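/- Let $M$ be a compact connected smooth Riemannian manifold of dimension $d\ge 1$ without boundary which is two-point homogeneous (isometries act transitively on pairs of points at a given distance), and let $\nu$ be its normalized Riemannian measure. Let $\{S_{n,j}: n\ge 0,\ 1\le j\le \Gamma(n)\}$ be an orthonormal basis of $L^2(M,\nu;\mathbb{C})$ such that $S_{n,1},\dots,S_{n,\Gamma(n)}$ are eigenfunctions of the Laplace–Beltrami operator for its $n$-th distinct eigenvalue ($\Gamma(n)$ is the dimension of the eigenspace). Let $X=\{X_t\}_{t\in\mathbb{Z}}$ be a zero-mean sequence of random elements of $L^2(M,\nu;\mathbb{R})$ on a probability space, with $E\|X_t\|^4<\infty$, which is stationary up to order four: $\mathcal{R}_\tau=E[X_s\otimes X_{s+\tau}]=E[X_{s+\tau}\otimes X_s]$ does not depend on $s\in\mathbb{Z}$, and the fourth-order cumulant kernels satisfy $\mathrm{cum}(X_{a+h},X_{b+h},X_{c+h},X_{e+h})=\mathrm{cum}(X_a,X_b,X_c,X_e)$ in $L^2(M^4)$ for all $a,b,c,e,h\in\mathbb{Z}$. ($H_1$) Assume that $X$ has the spectral density operators $\mathcal{F}_\omega=\mathcal{M}_\omega|\omega|^{-\mathcal{A}}$,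 $\omega\in[-\pi,\pi]\setminus\{0\}$, that is, $\mathcal{R}_\tau=\int_{-\pi}^{\pi}e^{i\omega\tau}\mathcal{F}_\omega\,d\omega$ (weakly) for all $\tau\in\mathbb{Z}$, where $\mathcal{A}$ and $\mathcal{M}_\omega$ are bounded operators on $L^2(M,\nu;\mathbb{C})$ with $\mathcal{A}S_{n,j}=\alpha(n)S_{n,j}$ and $\mathcal{M}_\omega S_{n,j}=M_n(\omega)S_{n,j}$ for all $n,j$, and $|\omega|^{-\mathcal{A}}=\exp(-\log|\omega|\,\mathcal{A})$; thus $\mathcal{F}_\omega$ has the eigenvalues $f_n(\omega)=M_n(\omega)|\omega|^{-\alpha(n)}$. Here $l_\alpha\le\alpha(n)\le L_\alpha$ for all $n$ with $0<l_\alpha\le L_\alpha<1/2$; each $M_n$ is positive and continuous on $[-\pi,\pi]$ and slowly varying at $0$ in Zygmund's sense (for each $\delta>0$, on some interval $(0,\varepsilon)$ the function $\omega^{\delta}M_n(\omega)$ is nondecreasing and $\omega^{-\delta}M_n(\omega)$ is nonincreasing); and $\sum_{\tau\in\mathbb{Z}}\sum_{n\ge0}\Gamma(n)\left|\int_{-\pi}^{\pi}e^{i\omega\tau}M_n(\omega)\,d\omega\right|<\infty$.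 (Assumption I) For all $t_1,t_2,t_3\in\mathbb{Z}$ the kernel $\mathrm{cum}(X_{t_1},X_{t_2},X_{t_3},X_0)\in L^2(M^4)$ is invariant under the isometries of $M$ (acting on all four variables simultaneously), and $\sum_{t_1,t_2,t_3\in\mathbb{Z}}\|\mathrm{cum}(X_{t_1},X_{t_2},X_{t_3},X_0)\|^2_{L^2(M^4)}<\infty$. Assume moreover that $\int_{-\pi}^{\pi}\|\mathcal{M}_\omega\|_{1}^2\,|\omega|^{-2L_\alpha}\,d\omega<\infty$, where $\|\cdot\|_1$ is the trace norm. Let $W:\mathbb{R}\to[0,\infty)$ be even and of bounded variation, with $W(x)=0$ for $|x|\ge1$, $\int W^2<\infty$ and $\int W=1$. For $T\ge2$ and a bandwidth $B_T>0$ put $$\widetilde X^{(T)}_\omega(x)=\frac1{\sqrt{2\pi T}}\sum_{t=0}^{T-1}X_t(x)e^{-i\omega t},\qquad p^{(T)}_\omega(x,y)=\widetilde X^{(T)}_\omega(x)\,\widetilde X^{(T)}_{-\omega}(y),$$ $$W^{(T)}(x)=\sum_{j\in\mathbb{Z}}\frac1{B_T}W\Big(\frac{x+2\pi j}{B_T}\Big),\qquad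 \widehat f^{(T)}_\omega(x,y)=\frac{2\pi}{T}\sum_{s=1}^{T-1}W^{(T)}\Big(\omega-\frac{2\pi s}{T}\Big)p^{(T)}_{2\pi s/T}(x,y),$$ and let the test statistic $\mathcal{S}_{B_T}$ be the integral operator on $L^2(M,\nu;\mathbb{C})$ with kernel $$\sqrt{B_TT}\int_{-\sqrt{B_T}/2}^{\sqrt{B_T}/2}\widehat f^{(T)}_\omega(x,y)\,\frac{d\omega}{\sqrt{B_T}}.$$ If $l_\alpha>1/4$ and $B_T=T^{-\beta}$ for some $\beta\in(0,1)$, then, almost surely, the Hilbert–Schmidt norm of $\mathcal{S}_{B_T}$ tends to $\infty$ as $T\to\infty$. -/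

import Mathlib

open MeasureTheory Filter Topology Bundle
open scoped Manifold ContDiff ENNReal

noncomputable section

/-! ### The manifold -/

section Manifold

/-- Two-point homogeneity: the isometry group is transitive on pairs of points at a given
distance. -/
def IsTwoPointHomogeneous (M : Type*) [MetricSpace M] : Prop :=
  ∀ p q p' q' : M, dist p q = dist p' q' → ∃ g : M ≃ᵢ M, g p = p' ∧ g q = q'

variable (d : ℕ) (M : Type*) [MetricSpace M] [MeasurableSpace M] [BorelSpace M]

/-- The normalized Riemannian measure of a compact `d`-dimensional Riemannian manifold with its
geodesic distance. The Riemannian volume is a constant multiple of the `d`-dimensional Hausdorff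
measure of the geodesic distance; the constant disappears in the normalization. -/
def riemannianProb : Measure M :=
  (Measure.hausdorffMeasure (X := M) (d : ℝ) Set.univ)⁻¹ •
    Measure.hausdorffMeasure (X := M) (d : ℝ)

instance riemannianProb_isFiniteMeasure : IsFiniteMeasure (riemannianProb d M) :=
  ⟨by
    simp only [riemannianProb, Measure.smul_apply, smul_eq_mul]
    exact lt_of_le_of_lt (ENNReal.inv_mul_le_one _) ENNReal.one_lt_top⟩

variable [ChartedSpace (EuclideanSpace ℝ (Fin d)) M] [IsManifold (𝓡 d) ∞ M]
  [RiemannianBundle (fun x : M => TangentSpace (𝓡 d) x)]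

variable {M} in
/-- The Riemannian gradient of a function on `M`: the tangent vector which represents the
differential. -/
def riemannianGrad (f : M → ℝ) (x : M) : TangentSpace (𝓡 d) x :=
  haveI : FiniteDimensional ℝ (TangentSpace (𝓡 d) x) :=
    inferInstanceAs (FiniteDimensional ℝ (EuclideanSpace ℝ (Fin d)))
  haveI : CompleteSpace (TangentSpace (𝓡 d) x) := FiniteDimensional.complete ℝ _
  (InnerProductSpace.toDual ℝ (TangentSpace (𝓡 d) x)).symm (mfderiv (𝓡 d) 𝓘(ℝ, ℝ) f x)

variable {M} in
/-- `f` is a smooth real function with `-Δ f = lam • f`, where `Δ` is the Laplace--Beltrami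
operator (Green's formula on a closed manifold). -/
def IsRealLaplaceEigenfunction (lam : ℝ) (f : M → ℝ) : Prop :=
  ContMDiff (𝓡 d) 𝓘(ℝ, ℝ) ∞ f ∧
    ∀ φ : M → ℝ, ContMDiff (𝓡 d) 𝓘(ℝ, ℝ) ∞ φ →
      ∫ x, inner ℝ (riemannianGrad d f x) (riemannianGrad d φ x) ∂(riemannianProb d M) =
        lam * ∫ x, f x * φ x ∂(riemannianProb d M)

/-- An orthonormal basis `S n j`, `j = 1, …, Γ(n)`, of `L²(M; ℂ)` made of eigenfunctions of the
Laplace--Beltrami operator, where `eigenvalue n` is the `n`-th distinct eigenvalue of `-Δ`.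
Since the basis is complete and the eigenvalues are distinct, `mult n = Γ(n)` is the dimension of
the `n`-th eigenspace. -/
structure LaplaceBeltramiBasis where
  eigenvalue : ℕ → ℝ
  eigenvalue_strictMono : StrictMono eigenvalue
  mult : ℕ → ℕ
  mult_pos : ∀ n, 0 < mult n
  S : HilbertBasis (Σ n, Fin (mult n)) ℂ (Lp ℂ 2 (riemannianProb d M))
  isEigenfunction : ∀ n (j : Fin (mult n)), ∃ f : M → ℂ,
    IsRealLaplaceEigenfunction d (eigenvalue n) (fun x => (f x).re) ∧
    IsRealLaplaceEigenfunction d (eigenvalue n) (fun x => (f x).im) ∧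
    S ⟨n, j⟩ =ᵐ[riemannianProb d M] f

end Manifold

/-! ### Operators on a Hilbert space -/

section Operators

variable {H : Type*} [NormedAddCommGroup H] [InnerProductSpace ℂ H]

/-- The trace (nuclear) norm, as the supremum of `∑ |⟨eᵢ, A fᵢ⟩|` over finite orthonormal
families `e`, `f`. -/
def traceNorm (A : H →L[ℂ] H) : ℝ≥0∞ :=
  ⨆ (k : ℕ) (e : Fin k → H) (f : Fin k → H) (_ : Orthonormal ℂ e) (_ : Orthonormal ℂ f),
    ∑ i, ‖inner ℂ (e i) (A (f i))‖ₑ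

/-- The operator `|θ|^{-A} = exp (-log |θ| A)` for a bounded operator `A` (used for `θ ≠ 0`). -/
def absRpowNeg [CompleteSpace H] (θ : ℝ) (A : H →L[ℂ] H) : H →L[ℂ] H :=
  NormedSpace.exp ((-Real.log |θ| : ℂ) • A)

/-- `A` is diagonal in the family `S n j`, with the eigenvalue `a n` on all `S n j`. -/
def IsDiagonalWith {mult : ℕ → ℕ} (S : (Σ n, Fin (mult n)) → H) (A : H →L[ℂ] H) (a : ℕ → ℝ) :
    Prop :=
  ∀ n (j : Fin (mult n)), A (S ⟨n, j⟩) = (a n : ℂ) • S ⟨n, j⟩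

end Operators

/-- Slow variation at `0` in the sense of Zygmund. -/
def ZygmundSlowlyVaryingAtZero (L : ℝ → ℝ) : Prop :=
  ∀ δ : ℝ, 0 < δ → ∃ ε > 0, MonotoneOn (fun θ => θ ^ δ * L θ) (Set.Ioo 0 ε) ∧
    AntitoneOn (fun θ => θ ^ (-δ) * L θ) (Set.Ioo 0 ε)

/-! ### Functional time series with values in `L²` -/

section Series

variable {M : Type*} [MeasurableSpace M] {ν : Measure M}
variable {Ω : Type*} [MeasurableSpace Ω]

/-- A real square integrable function, seen as a complex one. -/
def toComplexL2 (u : Lp ℝ 2 ν) : Lp ℂ 2 ν := Complex.ofRealCLM.compLp u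

/-- The cross-covariance operator `E[X_s ⊗ X_t]` of a zero-mean sequence, on complex functions:
`u ↦ E[⟨X_s, u⟩ X_t]`. -/
def crossCov (P : Measure Ω) (X : ℤ → Ω → Lp ℝ 2 ν) (s t : ℤ) (u : Lp ℂ 2 ν) : Lp ℂ 2 ν :=
  ∫ w, inner ℂ (toComplexL2 (X s w)) u • toComplexL2 (X t w) ∂P

theorem memLp_tensor4 [IsFiniteMeasure ν] (f : Fin 4 → Lp ℝ 2 ν) :
    MemLp (fun x : Fin 4 → M => ∏ i, f i (x i)) 2 (Measure.pi fun _ => ν) := by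
  have hm : AEStronglyMeasurable (fun x : Fin 4 → M => ∏ i, f i (x i))
      (Measure.pi fun _ => ν) := by
    refine (Integrable.fintype_prod (μ := fun _ : Fin 4 => ν)
      (f := fun i => (f i : M → ℝ)) fun i => ?_).aestronglyMeasurable
    exact (Lp.memLp (f i)).integrable (by norm_num)
  rw [memLp_two_iff_integrable_sq hm]
  simp_rw [← Finset.prod_pow]
  exact Integrable.fintype_prod (μ := fun _ : Fin 4 => ν)
    (f := fun i x => (f i x) ^ 2) fun i => (Lp.memLp (f i)).integrable_sq

/-- `f₁ ⊗ f₂ ⊗ f₃ ⊗ f₄` as an element of `L²(M⁴)`. -/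
def tensor4 [IsFiniteMeasure ν] (f₁ f₂ f₃ f₄ : Lp ℝ 2 ν) :
    Lp ℝ 2 (Measure.pi fun _ : Fin 4 => ν) :=
  (memLp_tensor4 ![f₁, f₂, f₃, f₄]).toLp _

/-- The fourth-order cumulant `cum(X_a, X_b, X_c, X_e)` of a zero-mean sequence, as a kernel in
`L²(M⁴)`: the expectation of the fourfold tensor product minus the three pairings, each of which
is the expectation over two independent copies `w`, `w'` of the randomness. -/
def cum4 [IsFiniteMeasure ν] (P : Measure Ω) (X : ℤ → Ω → Lp ℝ 2 ν) (a b c e : ℤ) :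
    Lp ℝ 2 (Measure.pi fun _ : Fin 4 => ν) :=
  (∫ w, tensor4 (X a w) (X b w) (X c w) (X e w) ∂P)
    - (∫ w, ∫ w', tensor4 (X a w) (X b w) (X c w') (X e w') ∂P ∂P)
    - (∫ w, ∫ w', tensor4 (X a w) (X b w') (X c w) (X e w') ∂P ∂P)
    - (∫ w, ∫ w', tensor4 (X a w) (X b w') (X c w') (X e w) ∂P ∂P)

/-- Zero-mean sequence with finite fourth moments which is stationary up to order four: its
covariance operators `R_τ = E[X_s ⊗ X_{s+τ}] = E[X_{s+τ} ⊗ X_s]` do not depend on `s`, and its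
fourth-order cumulants are invariant under time shifts. -/
structure IsStationarySeries [IsFiniteMeasure ν] (P : Measure Ω) (X : ℤ → Ω → Lp ℝ 2 ν) :
    Prop where
  memLp : ∀ t, MemLp (X t) 4 P
  mean_zero : ∀ t, ∫ w, X t w ∂P = 0
  cov_shift : ∀ s τ : ℤ, crossCov P X s (s + τ) = crossCov P X 0 τ
  cov_symm : ∀ s τ : ℤ, crossCov P X (s + τ) s = crossCov P X 0 τ
  cum_shift : ∀ a b c e h : ℤ, cum4 P X (a + h) (b + h) (c + h) (e + h) = cum4 P X a b c e

/-- `F θ`, `θ ∈ [-π, π]`, is the spectral density operator family of `X`: the covariance operators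
`R_τ` are its Fourier coefficients, `R_τ = ∫_{-π}^{π} exp(iθτ) F_θ dθ` (weakly). -/
def IsSpectralDensity (P : Measure Ω) (X : ℤ → Ω → Lp ℝ 2 ν)
    (F : ℝ → Lp ℂ 2 ν →L[ℂ] Lp ℂ 2 ν) : Prop :=
  ∀ u v : Lp ℂ 2 ν,
    IntegrableOn (fun θ : ℝ => inner ℂ u (F θ v)) (Set.Icc (-Real.pi) Real.pi) ∧
    ∀ τ : ℤ, inner ℂ u (crossCov P X 0 τ v) =
      ∫ θ in (-Real.pi)..Real.pi, Complex.exp (Complex.I * θ * τ) * inner ℂ u (F θ v)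

/-- For all `t₁, t₂, t₃` the cumulant `cum(X_{t₁}, X_{t₂}, X_{t₃}, X_0)` is an isotropic
(isometry invariant) kernel, and the squares of the `L²(M⁴)` norms are summable. -/
structure AssumptionI [MetricSpace M] [IsFiniteMeasure ν] (P : Measure Ω)
    (X : ℤ → Ω → Lp ℝ 2 ν) : Prop where
  isotropic : ∀ (t₁ t₂ t₃ : ℤ) (g : M ≃ᵢ M),
    (fun x : Fin 4 → M => cum4 P X t₁ t₂ t₃ 0 (fun i => g (x i)))
      =ᵐ[Measure.pi fun _ => ν] cum4 P X t₁ t₂ t₃ 0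
  summable_sq : Summable fun t : ℤ × ℤ × ℤ => ‖cum4 P X t.1 t.2.1 t.2.2 0‖ ^ 2

/-! ### The test statistic -/

/-- The functional discrete Fourier transform of the sample `X_0, …, X_{T-1}`. -/
def fDFT (X : ℤ → Ω → Lp ℝ 2 ν) (T : ℕ) (w : Ω) (θ : ℝ) (x : M) : ℂ :=
  (1 / √(2 * Real.pi * T) : ℝ) *
    ∑ t ∈ Finset.range T, (X (t : ℤ) w x : ℂ) * Complex.exp (-Complex.I * θ * t)

/-- The kernel of the periodogram operator. -/
def periodogram (X : ℤ → Ω → Lp ℝ 2 ν) (T : ℕ) (w : Ω) (θ : ℝ) (x y : M) : ℂ :=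
  fDFT X T w θ x * fDFT X T w (-θ) y

/-- The weight functions `W` admitted in the smoothing of the periodogram. -/
structure IsWeightFunction (W : ℝ → ℝ) : Prop where
  nonneg : ∀ x, 0 ≤ W x
  even : ∀ x, W (-x) = W x
  boundedVariation : BoundedVariationOn W Set.univ
  eq_zero : ∀ x, 1 ≤ |x| → W x = 0
  sq_integrable : Integrable fun x => W x ^ 2
  integral_eq_one : ∫ x, W x = 1

/-- The `2π`-periodic weight with bandwidth `B`. -/
def periodizedWeight (W : ℝ → ℝ) (B x : ℝ) : ℝ :=
  ∑' j : ℤ, 1 / B * W ((x + 2 * Real.pi * j) / B)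

/-- The kernel of the weighted periodogram operator. -/
def weightedPeriodogram (W : ℝ → ℝ) (B : ℝ) (X : ℤ → Ω → Lp ℝ 2 ν) (T : ℕ) (w : Ω) (θ : ℝ)
    (x y : M) : ℂ :=
  (2 * Real.pi / T : ℝ) * ∑ s ∈ Finset.Icc 1 (T - 1),
    (periodizedWeight W B (θ - 2 * Real.pi * s / T) : ℂ) *
      periodogram X T w (2 * Real.pi * s / T) x y

/-- The kernel of the test statistic operator
`√(B T) ∫_{[-√B/2, √B/2]} F̂_θ dθ / √B`. -/
def testStatistic (W : ℝ → ℝ) (B : ℝ) (X : ℤ → Ω → Lp ℝ 2 ν) (T : ℕ) (w : Ω) (x y : M) : ℂ :=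
  (√(B * T) : ℝ) * ∫ θ in (-√B / 2)..(√B / 2), weightedPeriodogram W B X T w θ x y / (√B : ℝ)

/-- The Hilbert--Schmidt norm of the integral operator on `L²(M; ℂ)` with the kernel `k`, that is,
the norm of `k` in `L²(M × M; ℂ)`. -/
def hilbertSchmidtNorm (ν : Measure M) (k : M → M → ℂ) : ℝ :=
  (eLpNorm (fun z : M × M => k z.1 z.2) 2 (ν.prod ν)).toReal

end Series

/-! ### Long range dependence -/

section LRD

variable {d : ℕ} {M : Type*} [MetricSpace M] [MeasurableSpace M] [BorelSpace M]
  [ChartedSpace (EuclideanSpace ℝ (Fin d)) M] [IsManifold (𝓡 d) ∞ M]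
  [RiemannianBundle (fun x : M => TangentSpace (𝓡 d) x)]
  {Ω : Type*} [MeasurableSpace Ω]

/-- The hypothesis of long range dependence. The LRD operator `A` and the regular spectral
operators `𝓜 θ` are diagonal in the Laplace--Beltrami basis, with the eigenvalues `α n` and
`m n θ`, and `𝓜 θ ∘ |θ|^{-A}` is the spectral density operator family of `X`; thus its eigenvalues
are `f_n(θ) = m n θ |θ|^{-α n}`. The numbers `α n` lie in `[l, L]` with `0 < l` and `L < 1/2`. -/
structure IsLRD (P : Measure Ω) (X : ℤ → Ω → Lp ℝ 2 (riemannianProb d M))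
    (b : LaplaceBeltramiBasis d M)
    (A : Lp ℂ 2 (riemannianProb d M) →L[ℂ] Lp ℂ 2 (riemannianProb d M)) (α : ℕ → ℝ)
    (𝓜 : ℝ → Lp ℂ 2 (riemannianProb d M) →L[ℂ] Lp ℂ 2 (riemannianProb d M)) (m : ℕ → ℝ → ℝ)
    (l L : ℝ) : Prop where
  l_pos : 0 < l
  L_lt : L < 1 / 2
  α_mem : ∀ n, α n ∈ Set.Icc l L
  A_diagonal : IsDiagonalWith b.S A α
  𝓜_diagonal : ∀ θ ∈ Set.Icc (-Real.pi) Real.pi, IsDiagonalWith b.S (𝓜 θ) (fun n => m n θ)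
  m_pos : ∀ n, ∀ θ ∈ Set.Icc (-Real.pi) Real.pi, 0 < m n θ
  m_continuous : ∀ n, ContinuousOn (m n) (Set.Icc (-Real.pi) Real.pi)
  m_slowlyVarying : ∀ n, ZygmundSlowlyVaryingAtZero (m n)
  m_summable : Summable fun p : ℤ × ℕ => (b.mult p.2 : ℝ) *
    ‖∫ θ in (-Real.pi)..Real.pi, Complex.exp (Complex.I * θ * p.1) * (m p.2 θ : ℂ)‖
  spectralDensity : IsSpectralDensity P X (fun θ => 𝓜 θ ∘L absRpowNeg θ A)

end LRD

end

/-!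
# Almost sure divergence of the test statistic under long range dependence

The kernel of the statistic is a combination, with nonnegative weights, of the periodogram kernels
at the Fourier frequencies `2πs/T`. Tested against the constant function it gives

  `Q_T = T^{-3/2} ∑_{s=1}^{T-1} a_s |∑_{t<T} Y_t exp(-2πist/T)|²`,   `Y_t = ∫ X_t dν`,

which is a lower bound for the Hilbert--Schmidt norm since `ν` has mass at most one
(`le_hilbertSchmidtNorm_testStatistic`). Here `a_s ≥ 0`, and `a_s ≥ 1` at the frequencies within
`√B/4` of `2πℤ`. So it suffices that `Q_T → ∞` almost surely, a statement about the scalar series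
`Y` (`ae_tendsto_atTop_weighted_energy`).

The spectral density of `Y` is `φ(θ) = ⟨1, F_θ 1⟩ = ∑ |⟨S, 1⟩|² f_n(θ)`. Some basis function `S` has
a nonzero coefficient, and each `m_n` is bounded below, so `φ(θ) ≥ c θ^{-l}` near zero. The trace
norm hypothesis gives `φ ∈ L²`, hence the autocovariances of `Y` are square summable; the fourth
cumulants of `Y` are square summable because they are integrals of the cumulant kernels.

A second moment bound at each `T` gives probabilities which are not summable in `T`, and `Q_T` is
not monotone. The remedy is a minorant of `Q_T` which does not depend on `T` in a block
`4^k ≤ T < 4^{k+1}`. Put `r = 2^k` and let `G` be the finite filter "`m`-fold average over `r`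
times, then difference at lag `r`" (`bandFilter`). Its transfer function is at most `2`, vanishes at
zero (the frequency `s = 0` is missing in `Q_T`), is bounded below at the frequencies in
`[1/(2r), 1/r]`, and decays like `(r|θ|)^{-m}`. As `B = T^{-β}` with `β < 1`, the band has a width
`√B` much larger than `1/r`, and for `m` large the side lobes outside the band are below `T^{-2}`.
By Parseval's identity for the cyclic group of order `T`, multiplication by `G` at the Fourier
frequencies is circular convolution, which is the ordinary filter `U = G * Y` except at the first
`deg G` times. Hence (`filtered_energy_le`)

  `∑_{t = D}^{4^k - 1} U_t² ≤ 8 r Q_T + C r^{-4} ∑_{t < 4^{k+1}} Y_t²`.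

The left side has a mean of order at least `r² · r^{l-1} = r^{1+l}` (`le_mean_bandEnergy`) and a
variance of order at most `r²` (`integral_bandEnergy_sub_sq_le`): the Gaussian part is controlled by
the square summability of the covariances, the cumulant part by the Cauchy--Schwarz inequality,
where the Frobenius norm of the quadratic form gains a factor `1/r` from the averaging. So its relative
variance is `O(4^{-kl})`, which is summable over `k`, and `Q_T ≥ c r^l` eventually, almost surely.
-/

/-! ### A band pass filter -/

open Polynomial in
/-- The `m`-th convolution power of the uniform average over `r` consecutive times, as a
generating polynomial. -/
noncomputable def averagingPoly (r m : ℕ) : ℝ[X] :=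
  (C (1 / (r : ℝ)) * ∑ i ∈ Finset.range r, X ^ i) ^ m

open Polynomial in
/-- The band pass filter `(averaging over r times)^m ∘ (difference at lag r)`, as a generating
polynomial: `coeff j` is the weight of the observation at lag `j`. -/
noncomputable def bandFilter (r m : ℕ) : ℝ[X] :=
  averagingPoly r m * (1 - X ^ r)

theorem averagingPoly_succ (r m : ℕ) : averagingPoly r (m + 1) =
    averagingPoly r m * averagingPoly r 1 := by
  simp [averagingPoly, pow_succ]

theorem averagingPoly_one_coeff (r j : ℕ) :
    (averagingPoly r 1).coeff j = if j < r then 1 / (r : ℝ) else 0 := by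
  simp [averagingPoly, Polynomial.coeff_X_pow]

theorem averagingPoly_coeff_nonneg (r m j : ℕ) : 0 ≤ (averagingPoly r m).coeff j := by
  induction m generalizing j with
  | zero => simp [averagingPoly, Polynomial.coeff_one]; split_ifs <;> norm_num
  | succ m ih =>
    rw [averagingPoly_succ, Polynomial.coeff_mul]
    refine Finset.sum_nonneg fun x _ => mul_nonneg (ih _) ?_
    rw [averagingPoly_one_coeff]; split_ifs <;> positivity

theorem averagingPoly_eval_one {r : ℕ} (hr : 0 < r) (m : ℕ) :
    (averagingPoly r m).eval 1 = 1 := by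
  have : (r : ℝ) ≠ 0 := by positivity
  simp [averagingPoly, Polynomial.eval_finsetSum, this]

theorem averagingPoly_natDegree_le (r m : ℕ) : (averagingPoly r m).natDegree ≤ m * r := by
  refine Polynomial.natDegree_pow_le_of_le m ?_
  refine (Polynomial.natDegree_C_mul_le _ _).trans ?_
  refine Polynomial.natDegree_sum_le_of_forall_le _ _ fun i hi => ?_
  simpa using (Finset.mem_range.1 hi).le

theorem averagingPoly_sum_coeff {r : ℕ} (hr : 0 < r) (m : ℕ) {n : ℕ} (hn : m * r < n) :
    ∑ j ∈ Finset.range n, (averagingPoly r m).coeff j = 1 := by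
  have h := averagingPoly_eval_one hr m
  rw [Polynomial.eval_eq_sum_range' ((averagingPoly_natDegree_le r m).trans_lt hn)] at h
  simpa using h

theorem averagingPoly_coeff_le {r : ℕ} (hr : 0 < r) (m j : ℕ) :
    (averagingPoly r (m + 1)).coeff j ≤ 1 / r := by
  rw [averagingPoly_succ, Polynomial.coeff_mul, Finset.Nat.sum_antidiagonal_eq_sum_range_succ_mk]
  calc ∑ k ∈ Finset.range (j + 1),
        (averagingPoly r m).coeff k * (averagingPoly r 1).coeff (j - k)
      ≤ ∑ k ∈ Finset.range (j + 1), (averagingPoly r m).coeff k * (1 / r) := by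
        refine Finset.sum_le_sum fun k _ =>
          mul_le_mul_of_nonneg_left ?_ (averagingPoly_coeff_nonneg r m k)
        rw [averagingPoly_one_coeff]; split_ifs
        · exact le_rfl
        · positivity
    _ = (∑ k ∈ Finset.range (j + 1), (averagingPoly r m).coeff k) * (1 / r) := by
        rw [Finset.sum_mul]
    _ ≤ 1 * (1 / r) := by
        refine mul_le_mul_of_nonneg_right ?_ (by positivity)
        rw [← averagingPoly_sum_coeff hr m (n := j + 1 + m * r) (by omega)]
        exact Finset.sum_le_sum_of_subset_of_nonneg
          (Finset.range_mono (by omega)) fun i _ _ => averagingPoly_coeff_nonneg r m i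
    _ = 1 / r := one_mul _

theorem bandFilter_coeff (r m j : ℕ) : (bandFilter r m).coeff j =
    (averagingPoly r m).coeff j - if r ≤ j then (averagingPoly r m).coeff (j - r) else 0 := by
  rw [bandFilter, mul_sub, mul_one, Polynomial.coeff_sub, Polynomial.coeff_mul_X_pow']

theorem bandFilter_natDegree_le (r m : ℕ) : (bandFilter r m).natDegree ≤ (m + 1) * r := by
  refine Polynomial.natDegree_mul_le.trans ?_
  have h1 := averagingPoly_natDegree_le r m
  have h2 : (1 - Polynomial.X ^ r : Polynomial ℝ).natDegree ≤ r :=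
    (Polynomial.natDegree_sub_le _ _).trans
      (max_le (by simp) (Polynomial.natDegree_X_pow_le r))
  linarith [add_mul m 1 r]

theorem bandFilter_abs_coeff_le {r : ℕ} (hr : 0 < r) (m j : ℕ) :
    |(bandFilter r (m + 1)).coeff j| ≤ 1 / r := by
  rw [bandFilter_coeff]
  have h0 := averagingPoly_coeff_nonneg r (m + 1)
  have h1 := averagingPoly_coeff_le hr m
  have h2 : (0 : ℝ) ≤ 1 / r := by positivity
  rw [abs_le]
  split_ifs
  · constructor <;> linarith [h0 j, h1 j, h0 (j - r), h1 (j - r)]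
  · constructor <;> linarith [h0 j, h1 j]

theorem bandFilter_sum_abs_coeff_le {r : ℕ} (hr : 0 < r) (m n : ℕ) :
    ∑ j ∈ Finset.range n, |(bandFilter r m).coeff j| ≤ 2 := by
  have h0 := averagingPoly_coeff_nonneg r m
  have hle : ∀ n, ∑ j ∈ Finset.range n, (averagingPoly r m).coeff j ≤ 1 := fun n => by
    rw [← averagingPoly_sum_coeff hr m (n := n + 1 + m * r) (by omega)]
    exact Finset.sum_le_sum_of_subset_of_nonneg
      (Finset.range_mono (by omega)) fun i _ _ => h0 i
  calc ∑ j ∈ Finset.range n, |(bandFilter r m).coeff j|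
      ≤ ∑ j ∈ Finset.range n, ((averagingPoly r m).coeff j +
          if r ≤ j then (averagingPoly r m).coeff (j - r) else 0) := by
        refine Finset.sum_le_sum fun j _ => ?_
        rw [bandFilter_coeff]
        refine (abs_sub _ _).trans (le_of_eq ?_)
        rw [abs_of_nonneg (h0 j), abs_of_nonneg]
        split_ifs
        exacts [h0 _, le_rfl]
    _ ≤ 1 + 1 := by
        rw [Finset.sum_add_distrib]
        refine add_le_add (hle n) ?_
        rw [← Finset.sum_filter]
        calc ∑ j ∈ Finset.range n with r ≤ j, (averagingPoly r m).coeff (j - r)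
            = ∑ i ∈ (Finset.range n).filter (r ≤ ·) |>.image (· - r),
                (averagingPoly r m).coeff i := by
              rw [Finset.sum_image]
              intro a ha b hb hab
              simp only [Finset.coe_filter, Set.mem_ofPred_eq] at ha hb hab
              omega
          _ ≤ ∑ j ∈ Finset.range n, (averagingPoly r m).coeff j := by
              refine Finset.sum_le_sum_of_subset_of_nonneg ?_ fun i _ _ => h0 i
              intro i hi
              simp only [Finset.mem_image, Finset.mem_filter, Finset.mem_range] at hi ⊢
              omega
          _ ≤ 1 := hle n
    _ = 2 := by norm_num

/-- The transfer function of the band pass filter at the frequency `θ`. -/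
noncomputable def bandTransfer (r m : ℕ) (θ : ℝ) : ℂ :=
  ∑ j ∈ Finset.range ((m + 1) * r + 1),
    ((bandFilter r m).coeff j : ℂ) * Complex.exp (-Complex.I * θ * j)

theorem bandTransfer_eq (r m : ℕ) (θ : ℝ) : bandTransfer r m θ =
    (1 / (r : ℂ) * ∑ i ∈ Finset.range r, Complex.exp (-Complex.I * θ) ^ i) ^ m *
      (1 - Complex.exp (-Complex.I * θ) ^ r) := by
  have h : bandTransfer r m θ =
      (bandFilter r m).eval₂ Complex.ofRealHom (Complex.exp (-Complex.I * θ)) := by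
    rw [Polynomial.eval₂_eq_sum_range'
      (hn := (bandFilter_natDegree_le r m).trans_lt (Nat.lt_succ_self _)), bandTransfer]
    refine Finset.sum_congr rfl fun j _ => ?_
    rw [← Complex.exp_nat_mul]
    simp [mul_comm]
  rw [h, bandFilter, averagingPoly]
  simp [Polynomial.eval₂_mul, Polynomial.eval₂_finsetSum, Polynomial.eval₂_pow]

theorem bandTransfer_zero {r m : ℕ} : bandTransfer r m 0 = 0 := by
  simp [bandTransfer_eq]

theorem bandTransfer_add_two_pi (r m : ℕ) (θ : ℝ) (j : ℤ) :
    bandTransfer r m (θ + 2 * Real.pi * j) = bandTransfer r m θ := by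
  have : Complex.exp (-Complex.I * ((θ + 2 * Real.pi * j : ℝ) : ℂ)) =
      Complex.exp (-Complex.I * θ) := by
    rw [Complex.exp_eq_exp_iff_exists_int]
    exact ⟨-j, by push_cast; ring⟩
  rw [bandTransfer_eq, bandTransfer_eq, this]

theorem norm_bandTransfer_le_two {r : ℕ} (hr : 0 < r) (m : ℕ) (θ : ℝ) :
    ‖bandTransfer r m θ‖ ≤ 2 := by
  refine (norm_sum_le _ _).trans (le_trans (le_of_eq ?_)
    (bandFilter_sum_abs_coeff_le hr m ((m + 1) * r + 1)))
  refine Finset.sum_congr rfl fun j _ => ?_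
  have : -Complex.I * θ * j = ((-(θ * j) : ℝ) : ℂ) * Complex.I := by push_cast; ring
  rw [norm_mul, this, Complex.norm_exp_ofReal_mul_I, mul_one, Complex.norm_real, Real.norm_eq_abs]

theorem norm_one_sub_exp_neg (θ : ℝ) :
    ‖1 - Complex.exp (-Complex.I * θ)‖ = 2 * |Real.sin (θ / 2)| := by
  have h := Complex.norm_exp_I_mul_ofReal_sub_one (-θ)
  rw [norm_sub_rev]
  have : -Complex.I * θ = Complex.I * ((-θ : ℝ) : ℂ) := by push_cast; ring
  rw [this, h, neg_div, Real.sin_neg]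
  simp

theorem two_div_pi_mul_abs_le_norm_one_sub_exp {θ : ℝ} (hθ : |θ| ≤ Real.pi) :
    2 / Real.pi * |θ| ≤ ‖1 - Complex.exp (-Complex.I * θ)‖ := by
  rw [norm_one_sub_exp_neg]
  have h : |Real.sin (θ / 2)| = Real.sin |θ / 2| := by
    rcases le_total 0 (θ / 2) with h | h
    · rw [abs_of_nonneg h, abs_of_nonneg]
      exact Real.sin_nonneg_of_nonneg_of_le_pi h (by linarith [le_abs_self θ, Real.pi_pos])
    · rw [abs_of_nonpos h, Real.sin_neg, abs_of_nonpos]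
      exact Real.sin_nonpos_of_nonpos_of_neg_pi_le h (by linarith [neg_abs_le θ, Real.pi_pos])
  rw [h]
  have h2 := Real.mul_le_sin (x := |θ / 2|) (abs_nonneg _)
    (by rw [abs_div, abs_two]; linarith)
  rw [abs_div, abs_two] at h2 ⊢
  linarith

/-- Decay of the side lobes. -/
theorem norm_bandTransfer_le {r : ℕ} (hr : 0 < r) (m : ℕ) {θ : ℝ} (h0 : θ ≠ 0)
    (hθ : |θ| ≤ Real.pi) : ‖bandTransfer r m θ‖ ≤ 2 * (Real.pi / (r * |θ|)) ^ m := by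
  have hr' : (0 : ℝ) < r := by positivity
  have habs : 0 < |θ| := abs_pos.2 h0
  set z := Complex.exp (-Complex.I * θ) with hz
  have hz1 : ‖z‖ = 1 := by
    have : -Complex.I * θ = ((-θ : ℝ) : ℂ) * Complex.I := by push_cast; ring
    rw [hz, this, Complex.norm_exp_ofReal_mul_I]
  have hb : ∀ n : ℕ, ‖1 - z ^ n‖ ≤ 2 := fun n => (norm_sub_le _ _).trans (by
    rw [norm_pow, hz1]; norm_num)
  have hlow := two_div_pi_mul_abs_le_norm_one_sub_exp hθ
  rw [← hz] at hlow
  have hpos : 0 < 2 / Real.pi * |θ| := by positivity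
  have hgeom : ‖∑ i ∈ Finset.range r, z ^ i‖ ≤ Real.pi / |θ| := by
    have h1 := mul_neg_geom_sum z r
    have h2 : ‖1 - z‖ * ‖∑ i ∈ Finset.range r, z ^ i‖ ≤ 2 := by
      rw [← norm_mul, h1]; exact hb r
    rw [le_div_iff₀ habs]
    have h3 : 2 / Real.pi * |θ| * ‖∑ i ∈ Finset.range r, z ^ i‖ ≤ 2 :=
      (mul_le_mul_of_nonneg_right hlow (norm_nonneg _)).trans h2
    have h4 : 2 / Real.pi * |θ| * ‖∑ i ∈ Finset.range r, z ^ i‖ =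
      2 / Real.pi * (‖∑ i ∈ Finset.range r, z ^ i‖ * |θ|) := by ring
    rw [h4, div_mul_eq_mul_div, div_le_iff₀ Real.pi_pos] at h3
    linarith
  rw [bandTransfer_eq, ← hz, norm_mul, norm_pow, mul_comm]
  refine mul_le_mul (hb r) (pow_le_pow_left₀ (norm_nonneg _) ?_ m) (by positivity) (by norm_num)
  rw [norm_mul, norm_div, norm_one, Complex.norm_natCast]
  calc 1 / (r : ℝ) * ‖∑ i ∈ Finset.range r, z ^ i‖ ≤ 1 / r * (Real.pi / |θ|) := by gcongr
    _ = Real.pi / (r * |θ|) := by field_simp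

/-- The pass band: the transfer function is bounded below at the frequencies of order `1 / r`. -/
theorem le_norm_bandTransfer {r : ℕ} (hr : 0 < r) (m : ℕ) {θ : ℝ} (h1 : 1 / (2 * r) ≤ θ)
    (h2 : θ ≤ 1 / r) : (1 / 2) ^ m * (1 / Real.pi) ≤ ‖bandTransfer r m θ‖ := by
  have hr' : (0 : ℝ) < r := by positivity
  have hθ : 0 ≤ θ := le_trans (by positivity) h1
  have hrθ : r * θ ≤ 1 := by rw [le_div_iff₀ hr'] at h2; linarith
  have hrθ' : 1 / 2 ≤ r * θ := by
    rw [div_le_iff₀ (by positivity)] at h1; linarith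
  set z := Complex.exp (-Complex.I * θ) with hz
  have hzn : ∀ n : ℕ, z ^ n = Complex.exp (-Complex.I * ((n * θ : ℝ) : ℂ)) := fun n => by
    rw [hz, ← Complex.exp_nat_mul]; push_cast; ring_nf
  rw [bandTransfer_eq, ← hz, norm_mul, norm_pow]
  refine mul_le_mul (pow_le_pow_left₀ (by norm_num) ?_ m) ?_ (by positivity) (by positivity)
  · -- each of the `r` terms of the average is within `1 / 2` of `1`
    have hsum : ‖(r : ℂ) - ∑ i ∈ Finset.range r, z ^ i‖ ≤ r * (1 / 2) := by
      have : (r : ℂ) - ∑ i ∈ Finset.range r, z ^ i = ∑ i ∈ Finset.range r, (1 - z ^ i) := by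
        simp [Finset.sum_sub_distrib]
      rw [this]
      calc ‖∑ i ∈ Finset.range r, (1 - z ^ i)‖ ≤ ∑ i ∈ Finset.range r, θ * i := by
            refine (norm_sum_le _ _).trans (Finset.sum_le_sum fun i _ => ?_)
            rw [hzn, norm_one_sub_exp_neg]
            have h := Real.abs_sin_le_abs (x := (i * θ : ℝ) / 2)
            rw [abs_of_nonneg (a := (i * θ : ℝ) / 2) (by positivity)] at h
            linarith
        _ = θ * (∑ i ∈ Finset.range r, (i : ℝ)) := by rw [Finset.mul_sum]
        _ ≤ θ * (r * r / 2) := by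
            refine mul_le_mul_of_nonneg_left ?_ hθ
            have h := Finset.sum_range_id_mul_two r
            have h' : (∑ i ∈ Finset.range r, (i : ℝ)) * 2 = (r : ℝ) * ((r - 1 : ℕ) : ℝ) := by
              rw [← Nat.cast_mul, ← h]; push_cast; rfl
            have h3 : ((r - 1 : ℕ) : ℝ) ≤ r := by exact_mod_cast Nat.sub_le r 1
            nlinarith
        _ ≤ r * (1 / 2) := by nlinarith
    have hn : (r : ℝ) * (1 / 2) ≤ ‖∑ i ∈ Finset.range r, z ^ i‖ := by
      have := norm_sub_norm_le (r : ℂ) (∑ i ∈ Finset.range r, z ^ i)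
      rw [Complex.norm_natCast] at this
      linarith
    rw [norm_mul, norm_div, norm_one, Complex.norm_natCast, one_div_mul_eq_div, le_div_iff₀ hr']
    linarith
  · rw [hzn]
    have := two_div_pi_mul_abs_le_norm_one_sub_exp (θ := r * θ)
      (by rw [abs_of_nonneg (by positivity)]; linarith [Real.pi_gt_three])
    rw [abs_of_nonneg (by positivity)] at this
    refine le_trans ?_ this
    rw [div_mul_eq_mul_div]
    gcongr
    linarith

/-! ### Circular filtering -/

/-- Parseval's identity for the finite Fourier transform. -/
theorem sum_norm_sq_finite_fourier {T : ℕ} (hT : 0 < T) (v : ℕ → ℂ) :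
    ∑ s ∈ Finset.range T, ‖∑ t ∈ Finset.range T, v t *
      Complex.exp (-Complex.I * (2 * Real.pi * s / T) * t)‖ ^ 2 =
      T * ∑ t ∈ Finset.range T, ‖v t‖ ^ 2 := by
  set ζ : ℂ := Complex.exp (-Complex.I * (2 * Real.pi / T)) with hζ
  have hT' : (T : ℂ) ≠ 0 := by exact_mod_cast hT.ne'
  have hprim : IsPrimitiveRoot ζ T := by
    have h := (Complex.isPrimitiveRoot_exp T hT.ne').inv
    rwa [← Complex.exp_neg, show -(2 * Real.pi * Complex.I / T : ℂ) =
      -Complex.I * (2 * Real.pi / T) by ring] at h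
  have hterm : ∀ s t : ℕ, Complex.exp (-Complex.I * (2 * Real.pi * s / T) * t) = (ζ ^ t) ^ s := by
    intro s t
    rw [hζ, ← Complex.exp_nat_mul, ← Complex.exp_nat_mul]; congr 1; ring
  have hconj : (starRingEnd ℂ) ζ = ζ⁻¹ := by
    have : ‖ζ‖ = 1 := hprim.norm'_eq_one hT.ne'
    rw [Complex.inv_def, Complex.normSq_eq_norm_sq, this]; simp
  have horth : ∀ t ∈ Finset.range T, ∀ t' ∈ Finset.range T,
      ∑ s ∈ Finset.range T, (ζ ^ t) ^ s * (starRingEnd ℂ) ((ζ ^ t') ^ s) =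
        if t = t' then (T : ℂ) else 0 := by
    intro t ht t' ht'
    have hne := hprim.ne_zero hT.ne'
    have h1 : ∀ s : ℕ, (ζ ^ t) ^ s * (starRingEnd ℂ) ((ζ ^ t') ^ s) = (ζ ^ t * (ζ ^ t')⁻¹) ^ s := by
      intro s; rw [map_pow, map_pow, hconj, mul_pow, inv_pow, inv_pow]
    simp_rw [h1]
    split_ifs with h
    · subst h
      rw [mul_inv_cancel₀ (pow_ne_zero _ hne)]; simp
    · have hw : ζ ^ t * (ζ ^ t')⁻¹ ≠ 1 := by
        intro hw
        rw [mul_inv_eq_one₀ (pow_ne_zero _ hne)] at hw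
        exact h (hprim.pow_inj (Finset.mem_range.1 ht) (Finset.mem_range.1 ht') hw)
      have hg := mul_neg_geom_sum (ζ ^ t * (ζ ^ t')⁻¹) T
      have hp : (ζ ^ t * (ζ ^ t')⁻¹) ^ T = 1 := by
        rw [mul_pow, inv_pow, ← pow_mul, ← pow_mul, mul_comm t, mul_comm t', pow_mul, pow_mul,
          hprim.pow_eq_one]; simp
      rw [hp, sub_self, mul_eq_zero] at hg
      exact hg.resolve_left (sub_ne_zero.2 hw.symm)
  have key : (∑ s ∈ Finset.range T, ((‖∑ t ∈ Finset.range T, v t *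
      (ζ ^ t) ^ s‖ ^ 2 : ℝ) : ℂ)) = T * ∑ t ∈ Finset.range T, ((‖v t‖ ^ 2 : ℝ) : ℂ) := by
    simp_rw [Complex.ofReal_pow, ← Complex.mul_conj', map_sum, Finset.sum_mul_sum]
    rw [Finset.sum_comm]
    simp_rw [Finset.sum_comm (s := Finset.range T) (t := Finset.range T)
      (f := fun s j => v _ * (ζ ^ _) ^ s * (starRingEnd ℂ) (v j * (ζ ^ j) ^ s))]
    rw [Finset.mul_sum]
    refine Finset.sum_congr rfl fun t ht => ?_
    calc _ = ∑ t' ∈ Finset.range T, v t * (starRingEnd ℂ) (v t') *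
          ∑ s ∈ Finset.range T, (ζ ^ t) ^ s * (starRingEnd ℂ) ((ζ ^ t') ^ s) := by
          refine Finset.sum_congr rfl fun t' _ => ?_
          rw [Finset.mul_sum]
          refine Finset.sum_congr rfl fun s _ => ?_
          rw [map_mul]; ring
      _ = ∑ t' ∈ Finset.range T, v t * (starRingEnd ℂ) (v t') * if t = t' then (T : ℂ) else 0 :=
          Finset.sum_congr rfl fun t' ht' => by rw [horth t ht t' ht']
      _ = _ := by simp [Finset.mem_range.1 ht]; ring
  simp_rw [hterm]
  exact_mod_cast key

/-- Filtering by multiplication of the finite Fourier transform is circular convolution; it agrees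
with the convolution of the original sequence except at the first `D` times. -/
theorem sum_sq_filter_le {T D : ℕ} (hT : 0 < T) (g : ℕ → ℝ) (y : ℤ → ℝ) :
    T * ∑ t ∈ Finset.Ico D T, (∑ j ∈ Finset.range (D + 1), g j * y ((t : ℤ) - j)) ^ 2 ≤
      ∑ s ∈ Finset.range T,
        ‖∑ j ∈ Finset.range (D + 1), (g j : ℂ) *
            Complex.exp (-Complex.I * (2 * Real.pi * s / T) * j)‖ ^ 2 *
          ‖∑ t ∈ Finset.range T, (y t : ℂ) *
            Complex.exp (-Complex.I * (2 * Real.pi * s / T) * t)‖ ^ 2 := by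
  classical
  have hT' : (T : ℂ) ≠ 0 := by exact_mod_cast hT.ne'
  set pairs := Finset.range (D + 1) ×ˢ Finset.range T with hpairs
  set v : ℕ → ℂ := fun t => ∑ q ∈ pairs with (q.1 + q.2) % T = t, (g q.1 * y q.2 : ℂ) with hv
  have hprod : ∀ s : ℕ, (∑ j ∈ Finset.range (D + 1), (g j : ℂ) *
            Complex.exp (-Complex.I * (2 * Real.pi * s / T) * j)) *
          (∑ t ∈ Finset.range T, (y t : ℂ) *
            Complex.exp (-Complex.I * (2 * Real.pi * s / T) * t)) =
        ∑ t ∈ Finset.range T, v t * Complex.exp (-Complex.I * (2 * Real.pi * s / T) * t) := by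
    intro s
    rw [Finset.sum_mul_sum, ← Finset.sum_product', ← hpairs,
      ← Finset.sum_fiberwise_of_maps_to (t := Finset.range T) (g := fun q => (q.1 + q.2) % T)
        (fun q _ => Finset.mem_range.2 (Nat.mod_lt _ hT))]
    refine Finset.sum_congr rfl fun t _ => ?_
    rw [hv, Finset.sum_mul]
    refine Finset.sum_congr rfl fun q hq => ?_
    have hq2 := (Finset.mem_filter.1 hq).2
    have hexp : Complex.exp (-Complex.I * (2 * Real.pi * s / T) * t) =
        Complex.exp (-Complex.I * (2 * Real.pi * s / T) * q.1) *
        Complex.exp (-Complex.I * (2 * Real.pi * s / T) * q.2) := by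
      rw [← Complex.exp_add, Complex.exp_eq_exp_iff_exists_int]
      have h := Nat.mod_add_div (q.1 + q.2) T
      rw [hq2] at h
      generalize (q.1 + q.2) / T = k at h
      refine ⟨s * k, ?_⟩
      have h' : (q.1 : ℂ) + q.2 = t + T * k := by exact_mod_cast h.symm
      have h2 : -Complex.I * (2 * Real.pi * s / T) * q.1 + -Complex.I * (2 * Real.pi * s / T) * q.2
        = -Complex.I * (2 * Real.pi * s / T) * ((q.1 : ℂ) + q.2) := by ring
      rw [h2, h']
      push_cast
      field_simp
      ring
    rw [hexp]; ring
  have hvt : ∀ t ∈ Finset.Ico D T,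
      v t = ((∑ j ∈ Finset.range (D + 1), g j * y ((t : ℤ) - j) : ℝ) : ℂ) := by
    intro t ht
    have ht' := Finset.mem_Ico.1 ht
    push_cast
    refine Finset.sum_bij' (fun q _ => q.1) (fun j _ => (j, t - j)) ?_ ?_ ?_ ?_ ?_
    · intro q hq
      simp only [hpairs, Finset.mem_filter, Finset.mem_product] at hq
      exact hq.1.1
    · intro j hj
      have hj' := Finset.mem_range.1 hj
      simp only [hpairs, Finset.mem_filter, Finset.mem_product, Finset.mem_range]
      refine ⟨⟨hj', by omega⟩, ?_⟩
      rw [show j + (t - j) = t by omega]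
      exact Nat.mod_eq_of_lt ht'.2
    · intro q hq
      have hq1 : q.1 + q.2 = t := by
        simp only [hpairs, Finset.mem_filter, Finset.mem_product, Finset.mem_range] at hq
        obtain ⟨⟨h1, h2⟩, h3⟩ := hq
        have hlt : (q.1 + q.2) / T < 1 ∨ 1 ≤ (q.1 + q.2) / T := lt_or_ge _ _
        have hmd := Nat.mod_add_div (q.1 + q.2) T
        rcases hlt with h | h
        · rw [Nat.lt_one_iff.1 h] at hmd; omega
        · have : T * 1 ≤ T * ((q.1 + q.2) / T) := Nat.mul_le_mul_left T h
          omega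
      ext
      · rfl
      · simp; omega
    · intro j hj; rfl
    · intro q hq
      have hq1 : q.1 + q.2 = t := by
        simp only [hpairs, Finset.mem_filter, Finset.mem_product, Finset.mem_range] at hq
        obtain ⟨⟨h1, h2⟩, h3⟩ := hq
        have hlt : (q.1 + q.2) / T < 1 ∨ 1 ≤ (q.1 + q.2) / T := lt_or_ge _ _
        have hmd := Nat.mod_add_div (q.1 + q.2) T
        rcases hlt with h | h
        · rw [Nat.lt_one_iff.1 h] at hmd; omega
        · have : T * 1 ≤ T * ((q.1 + q.2) / T) := Nat.mul_le_mul_left T h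
          omega
      have : (t : ℤ) - q.1 = q.2 := by omega
      simp [this]
  simp_rw [← mul_pow, ← norm_mul, hprod]
  rw [sum_norm_sq_finite_fourier hT]
  refine mul_le_mul_of_nonneg_left ?_ (Nat.cast_nonneg _)
  calc ∑ t ∈ Finset.Ico D T, (∑ j ∈ Finset.range (D + 1), g j * y ((t : ℤ) - j)) ^ 2
      = ∑ t ∈ Finset.Ico D T, ‖v t‖ ^ 2 := Finset.sum_congr rfl fun t ht => by
        rw [hvt t ht, Complex.norm_real, Real.norm_eq_abs, sq_abs]
    _ ≤ ∑ t ∈ Finset.range T, ‖v t‖ ^ 2 :=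
        Finset.sum_le_sum_of_subset_of_nonneg
          (fun t ht => Finset.mem_range.2 (Finset.mem_Ico.1 ht).2) fun _ _ _ => by positivity

/-! ### Quadratic forms of a scalar series -/

section Quadratic

variable {Ω : Type*} [MeasurableSpace Ω] {P : Measure Ω}

theorem MeasureTheory.MemLp.mul_four_two {f g : Ω → ℝ} (hf : MemLp f 4 P) (hg : MemLp g 4 P) :
    MemLp (fun w => f w * g w) 2 P := by
  have : ENNReal.HolderTriple 4 4 2 := ⟨by
    rw [← two_mul, show (4 : ℝ≥0∞) = 2 * 2 by norm_num,
      ENNReal.mul_inv (by norm_num) (by norm_num), ← mul_assoc,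
      ENNReal.mul_inv_cancel (by norm_num) (by norm_num), one_mul]⟩
  exact hg.mul hf

theorem integrable_mul_of_memLp_four [IsFiniteMeasure P] {f g : Ω → ℝ}
    (hf : MemLp f 4 P) (hg : MemLp g 4 P) :
    Integrable (fun w => f w * g w) P :=
  (hf.mul_four_two hg).integrable (by norm_num)

theorem integrable_mul_four {f g h k : Ω → ℝ} (hf : MemLp f 4 P) (hg : MemLp g 4 P)
    (hh : MemLp h 4 P) (hk : MemLp k 4 P) :
    Integrable (fun w => f w * g w * (h w * k w)) P :=
  (hf.mul_four_two hg).integrable_mul (hh.mul_four_two hk)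

variable [IsProbabilityMeasure P] {Y : ℕ → Ω → ℝ}

theorem integral_quadratic_form (hY : ∀ t, MemLp (Y t) 4 P) {γ : ℤ → ℝ}
    (h2 : ∀ s t : ℕ, ∫ w, Y s w * Y t w ∂P = γ (t - s)) (N : ℕ) (a : ℕ × ℕ → ℝ) :
    ∫ w, ∑ p ∈ Finset.range N ×ˢ Finset.range N, a p * (Y p.1 w * Y p.2 w) ∂P =
      ∑ p ∈ Finset.range N ×ˢ Finset.range N, a p * γ (p.2 - p.1) := by
  rw [integral_finsetSum _ fun p _ =>
    (integrable_mul_of_memLp_four (hY p.1) (hY p.2)).const_mul (a p)]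
  simp_rw [integral_const_mul, h2]

/-- The variance of a quadratic form is a sum of two pairings of covariances and a cumulant
term. -/
theorem integral_quadratic_form_sub_sq (hY : ∀ t, MemLp (Y t) 4 P) {γ : ℤ → ℝ}
    (h2 : ∀ s t : ℕ, ∫ w, Y s w * Y t w ∂P = γ (t - s)) {κ : ℕ → ℕ → ℕ → ℕ → ℝ}
    (h4 : ∀ a b c e : ℕ, ∫ w, Y a w * Y b w * (Y c w * Y e w) ∂P =
      γ (b - a) * γ (e - c) + γ (c - a) * γ (e - b) + γ (e - a) * γ (c - b) + κ a b c e)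
    (N : ℕ) (a : ℕ × ℕ → ℝ) :
    ∫ w, ((∑ p ∈ Finset.range N ×ˢ Finset.range N, a p * (Y p.1 w * Y p.2 w)) -
      ∑ p ∈ Finset.range N ×ˢ Finset.range N, a p * γ (p.2 - p.1)) ^ 2 ∂P =
      ∑ p ∈ Finset.range N ×ˢ Finset.range N, ∑ q ∈ Finset.range N ×ˢ Finset.range N,
        a p * a q * (γ (q.1 - p.1) * γ (q.2 - p.2) + γ (q.2 - p.1) * γ (q.1 - p.2) +
          κ p.1 p.2 q.1 q.2) := by
  set V := Finset.range N ×ˢ Finset.range N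
  set μ := ∑ p ∈ V, a p * γ (p.2 - p.1) with hμ
  have hint1 : Integrable (fun w => ∑ p ∈ V, a p * (Y p.1 w * Y p.2 w)) P :=
    integrable_finsetSum _ fun p _ =>
      (integrable_mul_of_memLp_four (hY p.1) (hY p.2)).const_mul (a p)
  have hint2 : ∀ p q : ℕ × ℕ, Integrable
      (fun w => a p * a q * (Y p.1 w * Y p.2 w * (Y q.1 w * Y q.2 w))) P := fun p q =>
    (integrable_mul_four (hY p.1) (hY p.2) (hY q.1) (hY q.2)).const_mul _
  have hsq : ∀ w, ((∑ p ∈ V, a p * (Y p.1 w * Y p.2 w)) - μ) ^ 2 =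
      (∑ p ∈ V, ∑ q ∈ V, a p * a q * (Y p.1 w * Y p.2 w * (Y q.1 w * Y q.2 w))) -
        2 * μ * (∑ p ∈ V, a p * (Y p.1 w * Y p.2 w)) + μ ^ 2 := by
    intro w
    have : (∑ p ∈ V, ∑ q ∈ V, a p * a q * (Y p.1 w * Y p.2 w * (Y q.1 w * Y q.2 w))) =
        (∑ p ∈ V, a p * (Y p.1 w * Y p.2 w)) * ∑ p ∈ V, a p * (Y p.1 w * Y p.2 w) := by
      rw [Finset.sum_mul_sum]
      exact Finset.sum_congr rfl fun p _ => Finset.sum_congr rfl fun q _ => by ring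
    rw [this]; ring
  simp_rw [hsq]
  have hint3 : Integrable (fun w => ∑ p ∈ V, ∑ q ∈ V,
      a p * a q * (Y p.1 w * Y p.2 w * (Y q.1 w * Y q.2 w))) P :=
    integrable_finsetSum _ fun p _ => integrable_finsetSum _ fun q _ => hint2 p q
  have hint4 : Integrable (fun w => 2 * μ * ∑ p ∈ V, a p * (Y p.1 w * Y p.2 w)) P :=
    hint1.const_mul _
  refine (integral_add (hint3.sub hint4) (integrable_const (μ ^ 2))).trans ?_
  rw [integral_sub' hint3 hint4, integral_const_mul, integral_quadratic_form hY h2, ← hμ,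
    integral_finsetSum _ fun p _ => integrable_finsetSum _ fun q _ => hint2 p q]
  simp_rw [fun p : ℕ × ℕ => integral_finsetSum V fun q _ => hint2 p q, integral_const_mul, h4]
  have hμ2 : ∑ p ∈ V, ∑ q ∈ V, a p * a q * (γ (p.2 - p.1) * γ (q.2 - q.1)) = μ * μ := by
    rw [hμ, Finset.sum_mul_sum]
    exact Finset.sum_congr rfl fun p _ => Finset.sum_congr rfl fun q _ => by ring
  have hsplit : ∑ p ∈ V, ∑ q ∈ V, a p * a q * (γ (p.2 - p.1) * γ (q.2 - q.1) +
        γ (q.1 - p.1) * γ (q.2 - p.2) + γ (q.2 - p.1) * γ (q.1 - p.2) + κ p.1 p.2 q.1 q.2) =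
      μ * μ + ∑ p ∈ V, ∑ q ∈ V, a p * a q * (γ (q.1 - p.1) * γ (q.2 - p.2) +
        γ (q.2 - p.1) * γ (q.1 - p.2) + κ p.1 p.2 q.1 q.2) := by
    rw [← hμ2, ← Finset.sum_add_distrib]
    refine Finset.sum_congr rfl fun p _ => ?_
    rw [← Finset.sum_add_distrib]
    exact Finset.sum_congr rfl fun q _ => by ring
  rw [hsplit]
  simp
  ring

/-- Sums of `γ²` over a square window, weighted by two matrices with bounded row sums. -/
theorem sum_window_sq_le {γ : ℤ → ℝ} (hγ : Summable fun τ => γ τ ^ 2) (N : ℕ) {x : ℕ → ℝ} {R : ℝ}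
    (hx0 : ∀ u, 0 ≤ x u) (hx : ∀ u, x u ≤ R) :
    ∑ u ∈ Finset.range N, ∑ v ∈ Finset.range N, x u * x v * γ (v - u) ^ 2 ≤
      R ^ 2 * N * ∑' τ, γ τ ^ 2 := by
  have hR : 0 ≤ R := (hx0 0).trans (hx 0)
  calc ∑ u ∈ Finset.range N, ∑ v ∈ Finset.range N, x u * x v * γ (v - u) ^ 2
      ≤ ∑ u ∈ Finset.range N, R ^ 2 * ∑' τ, γ τ ^ 2 := by
        refine Finset.sum_le_sum fun u _ => ?_
        calc ∑ v ∈ Finset.range N, x u * x v * γ (v - u) ^ 2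
            ≤ ∑ v ∈ Finset.range N, R ^ 2 * γ (v - u) ^ 2 := by
              refine Finset.sum_le_sum fun v _ => mul_le_mul_of_nonneg_right ?_ (sq_nonneg _)
              rw [sq]
              exact mul_le_mul (hx u) (hx v) (hx0 v) hR
          _ = R ^ 2 * ∑ τ ∈ (Finset.range N).image (fun v : ℕ => (v : ℤ) - u), γ τ ^ 2 := by
              rw [Finset.sum_image (fun a _ b _ hab => by simpa using hab), Finset.mul_sum]
          _ ≤ R ^ 2 * ∑' τ, γ τ ^ 2 :=
              mul_le_mul_of_nonneg_left (hγ.sum_le_tsum _ fun _ _ => sq_nonneg _) (sq_nonneg R)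
    _ = R ^ 2 * N * ∑' τ, γ τ ^ 2 := by simp; ring

/-- Variance bound for a symmetric quadratic form in terms of its row sums and its Frobenius
norm. -/
theorem integral_quadratic_form_sub_sq_le (hY : ∀ t, MemLp (Y t) 4 P) {γ : ℤ → ℝ}
    (h2 : ∀ s t : ℕ, ∫ w, Y s w * Y t w ∂P = γ (t - s)) {κ : ℕ → ℕ → ℕ → ℕ → ℝ}
    (h4 : ∀ a b c e : ℕ, ∫ w, Y a w * Y b w * (Y c w * Y e w) ∂P =
      γ (b - a) * γ (e - c) + γ (c - a) * γ (e - b) + γ (e - a) * γ (c - b) + κ a b c e)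
    (hγ : Summable fun τ => γ τ ^ 2) {K : ℝ} {N : ℕ}
    (hκ : ∑ p ∈ Finset.range N ×ˢ Finset.range N, ∑ q ∈ Finset.range N ×ˢ Finset.range N,
      κ p.1 p.2 q.1 q.2 ^ 2 ≤ N * K)
    {a : ℕ × ℕ → ℝ} (hsymm : ∀ u v, a (u, v) = a (v, u)) {R F : ℝ}
    (hR : ∀ u, ∑ v ∈ Finset.range N, |a (u, v)| ≤ R)
    (hF : ∑ p ∈ Finset.range N ×ˢ Finset.range N, a p ^ 2 ≤ F) :
    ∫ w, ((∑ p ∈ Finset.range N ×ˢ Finset.range N, a p * (Y p.1 w * Y p.2 w)) -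
      ∑ p ∈ Finset.range N ×ˢ Finset.range N, a p * γ (p.2 - p.1)) ^ 2 ∂P ≤
      2 * (R ^ 2 * N * ∑' τ, γ τ ^ 2) + F * √(N * K) := by
  rw [integral_quadratic_form_sub_sq hY h2 h4]
  set V := Finset.range N ×ˢ Finset.range N with hV
  set G := ∑' τ, γ τ ^ 2
  have hx0 : ∀ u, 0 ≤ ∑ v ∈ Finset.range N, |a (u, v)| := fun u =>
    Finset.sum_nonneg fun v _ => abs_nonneg _
  have hwin := sum_window_sq_le hγ N hx0 hR
  -- the four ways of choosing one index of each pair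
  have h11 : ∑ p ∈ V, ∑ q ∈ V, |a p| * |a q| * γ (q.1 - p.1) ^ 2 ≤ R ^ 2 * N * G := by
    refine le_trans (le_of_eq ?_) hwin
    rw [hV, Finset.sum_product]
    simp_rw [Finset.sum_product]
    refine Finset.sum_congr rfl fun u _ => ?_
    rw [Finset.sum_comm]
    refine Finset.sum_congr rfl fun u' _ => ?_
    rw [Finset.sum_mul_sum, Finset.sum_mul]
    exact Finset.sum_congr rfl fun v _ => by rw [Finset.sum_mul]
  have hswap : ∀ f : ℕ × ℕ → ℝ, ∑ p ∈ V, f p = ∑ p ∈ V, f p.swap := fun f => by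
    rw [hV, Finset.sum_product, Finset.sum_product_right]; rfl
  have hasw : ∀ p : ℕ × ℕ, a p.swap = a p := fun p => (hsymm _ _)
  have h21 : ∑ p ∈ V, ∑ q ∈ V, |a p| * |a q| * γ (q.1 - p.2) ^ 2 ≤ R ^ 2 * N * G := by
    rw [hswap]; simpa [hasw] using h11
  have h12 : ∑ p ∈ V, ∑ q ∈ V, |a p| * |a q| * γ (q.2 - p.1) ^ 2 ≤ R ^ 2 * N * G := by
    refine le_trans (le_of_eq ?_) h11
    refine Finset.sum_congr rfl fun p _ => ?_
    rw [hswap]; simp [hasw]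
  have h22 : ∑ p ∈ V, ∑ q ∈ V, |a p| * |a q| * γ (q.2 - p.2) ^ 2 ≤ R ^ 2 * N * G := by
    refine le_trans (le_of_eq ?_) h21
    refine Finset.sum_congr rfl fun p _ => ?_
    rw [hswap]; simp [hasw]
  have hgauss : ∑ p ∈ V, ∑ q ∈ V, a p * a q *
      (γ (q.1 - p.1) * γ (q.2 - p.2) + γ (q.2 - p.1) * γ (q.1 - p.2)) ≤
      2 * (R ^ 2 * N * G) := by
    calc _ ≤ ∑ p ∈ V, ∑ q ∈ V, (1 / 2) * (|a p| * |a q| * γ (q.1 - p.1) ^ 2 +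
          |a p| * |a q| * γ (q.2 - p.2) ^ 2 + |a p| * |a q| * γ (q.2 - p.1) ^ 2 +
          |a p| * |a q| * γ (q.1 - p.2) ^ 2) := by
          refine Finset.sum_le_sum fun p _ => Finset.sum_le_sum fun q _ => ?_
          have hab : ∀ x y : ℝ, |x * y| ≤ 1 / 2 * (x ^ 2 + y ^ 2) := fun x y => by
            rw [abs_mul]; nlinarith [sq_nonneg (|x| - |y|), sq_abs x, sq_abs y]
          calc _ ≤ |a p * a q| * |γ (q.1 - p.1) * γ (q.2 - p.2) +
                γ (q.2 - p.1) * γ (q.1 - p.2)| := (le_abs_self _).trans (abs_mul _ _).le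
            _ ≤ |a p * a q| * (1 / 2 * (γ (q.1 - p.1) ^ 2 + γ (q.2 - p.2) ^ 2) +
                1 / 2 * (γ (q.2 - p.1) ^ 2 + γ (q.1 - p.2) ^ 2)) := by
                refine mul_le_mul_of_nonneg_left ((abs_add_le _ _).trans ?_) (abs_nonneg _)
                exact add_le_add (hab _ _) (hab _ _)
            _ = _ := by rw [abs_mul]; ring
      _ ≤ _ := by
          simp_rw [← Finset.mul_sum, Finset.sum_add_distrib]
          linarith
  have hcum : ∑ p ∈ V, ∑ q ∈ V, a p * a q * κ p.1 p.2 q.1 q.2 ≤ F * √(N * K) := by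
    have hF0 : 0 ≤ ∑ p ∈ V, a p ^ 2 := Finset.sum_nonneg fun _ _ => sq_nonneg _
    rw [← Finset.sum_product' (s := V) (t := V)
      (f := fun p q => a p * a q * κ p.1 p.2 q.1 q.2)]
    refine (Real.sum_mul_le_sqrt_mul_sqrt _ _ _).trans ?_
    refine mul_le_mul ?_ (Real.sqrt_le_sqrt ?_) (Real.sqrt_nonneg _) (hF0.trans hF)
    · refine (Real.sqrt_le_left (hF0.trans hF)).2 ?_
      have : ∑ x ∈ V ×ˢ V, (a x.1 * a x.2) ^ 2 = (∑ p ∈ V, a p ^ 2) ^ 2 := by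
        rw [sq (∑ p ∈ V, a p ^ 2), Finset.sum_mul_sum, ← Finset.sum_product']
        exact Finset.sum_congr rfl fun x _ => by ring
      rw [this]
      exact pow_le_pow_left₀ hF0 hF 2
    · rw [Finset.sum_product]
      exact hκ
  calc _ = (∑ p ∈ V, ∑ q ∈ V, a p * a q *
      (γ (q.1 - p.1) * γ (q.2 - p.2) + γ (q.2 - p.1) * γ (q.1 - p.2))) +
      ∑ p ∈ V, ∑ q ∈ V, a p * a q * κ p.1 p.2 q.1 q.2 := by
        simp_rw [← Finset.sum_add_distrib, ← mul_add]
    _ ≤ _ := add_le_add hgauss hcum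

end Quadratic

/-! ### Filtered energy -/

/-- The matrix `∑ t ∈ [D, N), h (t - u) h (t - v)` of the energy of a causal filter `h`. -/
def energyMatrix (h : ℕ → ℝ) (D N : ℕ) (p : ℕ × ℕ) : ℝ :=
  ∑ t ∈ Finset.Ico D N, (if p.1 ≤ t then h (t - p.1) else 0) * (if p.2 ≤ t then h (t - p.2) else 0)

section Energy

variable {h : ℕ → ℝ} {D N : ℕ}

theorem energyMatrix_symm (h : ℕ → ℝ) (D N u v : ℕ) :
    energyMatrix h D N (u, v) = energyMatrix h D N (v, u) :=
  Finset.sum_congr rfl fun _ _ => mul_comm _ _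

theorem sum_filter_eq_sum_range (hD : ∀ j, D < j → h j = 0) {R : Type*} [CommRing R] [Algebra ℝ R]
    (f : ℤ → R) {t : ℕ} (ht : t ∈ Finset.Ico D N) :
    ∑ j ∈ Finset.range (D + 1), algebraMap ℝ R (h j) * f ((t : ℤ) - j) =
      ∑ u ∈ Finset.range N, algebraMap ℝ R (if u ≤ t then h (t - u) else 0) * f u := by
  have ht' := Finset.mem_Ico.1 ht
  have h1 : ∑ u ∈ Finset.range N, algebraMap ℝ R (if u ≤ t then h (t - u) else 0) * f u =
      ∑ u ∈ Finset.range (t + 1), algebraMap ℝ R (h (t - u)) * f u := by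
    symm
    rw [← Finset.sum_subset (Finset.range_mono (by omega : t + 1 ≤ N))]
    · refine Finset.sum_congr rfl fun u hu => ?_
      rw [if_pos (by simpa [Nat.lt_succ_iff] using hu)]
    · intro u _ hu
      rw [if_neg (by simpa [Nat.lt_succ_iff] using hu)]; simp
  rw [h1, ← Finset.sum_range_reflect (fun u : ℕ => algebraMap ℝ R (h (t - u)) * f u) (t + 1)]
  symm
  rw [← Finset.sum_subset (Finset.range_mono (by omega : D + 1 ≤ t + 1))]
  · refine Finset.sum_congr rfl fun j hj => ?_
    have := Finset.mem_range.1 hj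
    rw [show t - (t + 1 - 1 - j) = j by omega,
      show ((t + 1 - 1 - j : ℕ) : ℤ) = (t : ℤ) - j by omega]
  · intro j hj hj'
    simp only [Finset.mem_range] at hj hj'
    rw [show t - (t + 1 - 1 - j) = j by omega, hD j (by omega)]; simp

theorem sum_sq_filter_eq (hD : ∀ j, D < j → h j = 0) (y : ℤ → ℝ) :
    ∑ t ∈ Finset.Ico D N, (∑ j ∈ Finset.range (D + 1), h j * y ((t : ℤ) - j)) ^ 2 =
      ∑ p ∈ Finset.range N ×ˢ Finset.range N, energyMatrix h D N p * (y p.1 * y p.2) := by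
  simp_rw [energyMatrix, Finset.sum_mul]
  rw [Finset.sum_comm]
  refine Finset.sum_congr rfl fun t ht => ?_
  have := sum_filter_eq_sum_range (R := ℝ) hD y ht
  simp only [Algebra.algebraMap_self, RingHom.id_apply] at this
  rw [this, sq, Finset.sum_mul_sum, Finset.sum_product]
  exact Finset.sum_congr rfl fun _ _ => Finset.sum_congr rfl fun _ _ => by ring

theorem sum_row_abs_le (n : ℕ) {B : ℝ} (hB : ∀ n, ∑ j ∈ Finset.range n, |h j| ≤ B) (t : ℕ) :
    ∑ u ∈ Finset.range n, |if u ≤ t then h (t - u) else 0| ≤ B := by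
  refine le_trans ?_ (hB (t + 1))
  calc ∑ u ∈ Finset.range n, |if u ≤ t then h (t - u) else 0|
      = ∑ u ∈ (Finset.range n).filter (· ≤ t), |h (t - u)| := by
        rw [Finset.sum_filter]
        exact Finset.sum_congr rfl fun u _ => by split_ifs <;> simp
    _ ≤ ∑ u ∈ Finset.range (t + 1), |h (t - u)| :=
        Finset.sum_le_sum_of_subset_of_nonneg
          (fun u hu => Finset.mem_range.2 (Nat.lt_succ_iff.2 (Finset.mem_filter.1 hu).2))
          fun _ _ _ => abs_nonneg _
    _ = ∑ j ∈ Finset.range (t + 1), |h j| := by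
        rw [← Finset.sum_range_reflect]
        refine Finset.sum_congr rfl fun u hu => ?_
        have := Finset.mem_range.1 hu
        rw [show t - (t + 1 - 1 - u) = u by omega]

theorem sum_column_abs_le {B : ℝ} (hB : ∀ n, ∑ j ∈ Finset.range n, |h j| ≤ B) (D N u : ℕ) :
    ∑ t ∈ Finset.Ico D N, |if u ≤ t then h (t - u) else 0| ≤ B := by
  refine le_trans ?_ (hB N)
  calc ∑ t ∈ Finset.Ico D N, |if u ≤ t then h (t - u) else 0|
      ≤ ∑ t ∈ Finset.range N, |if u ≤ t then h (t - u) else 0| :=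
        Finset.sum_le_sum_of_subset_of_nonneg
          (fun t ht => Finset.mem_range.2 (Finset.mem_Ico.1 ht).2) fun _ _ _ => abs_nonneg _
    _ = ∑ t ∈ (Finset.range N).filter (u ≤ ·), |h (t - u)| := by
        rw [Finset.sum_filter]
        exact Finset.sum_congr rfl fun u _ => by split_ifs <;> simp
    _ = ∑ j ∈ ((Finset.range N).filter (u ≤ ·)).image (· - u), |h j| := by
        rw [Finset.sum_image]
        intro a ha b hb hab
        simp only [Finset.coe_filter, Set.mem_ofPred_eq] at ha hb hab
        omega
    _ ≤ ∑ j ∈ Finset.range N, |h j| := by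
        refine Finset.sum_le_sum_of_subset_of_nonneg ?_ fun _ _ _ => abs_nonneg _
        intro i hi
        simp only [Finset.mem_image, Finset.mem_filter, Finset.mem_range] at hi ⊢
        omega

theorem abs_energyMatrix_le_sum (p : ℕ × ℕ) : |energyMatrix h D N p| ≤
    ∑ t ∈ Finset.Ico D N, |if p.1 ≤ t then h (t - p.1) else 0| *
      |if p.2 ≤ t then h (t - p.2) else 0| := by
  refine (Finset.abs_sum_le_sum_abs _ _).trans (le_of_eq ?_)
  simp_rw [abs_mul]

theorem sum_abs_energyMatrix_le {B : ℝ} (hB : ∀ n, ∑ j ∈ Finset.range n, |h j| ≤ B) (u : ℕ) :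
    ∑ v ∈ Finset.range N, |energyMatrix h D N (u, v)| ≤ B * B := by
  have hB0 : 0 ≤ B := by simpa using hB 0
  calc ∑ v ∈ Finset.range N, |energyMatrix h D N (u, v)|
      ≤ ∑ v ∈ Finset.range N, ∑ t ∈ Finset.Ico D N, |if u ≤ t then h (t - u) else 0| *
          |if v ≤ t then h (t - v) else 0| :=
        Finset.sum_le_sum fun v _ => abs_energyMatrix_le_sum (u, v)
    _ = ∑ t ∈ Finset.Ico D N, |if u ≤ t then h (t - u) else 0| *
          ∑ v ∈ Finset.range N, |if v ≤ t then h (t - v) else 0| := by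
        rw [Finset.sum_comm]; simp_rw [Finset.mul_sum]
    _ ≤ ∑ t ∈ Finset.Ico D N, |if u ≤ t then h (t - u) else 0| * B :=
        Finset.sum_le_sum fun t _ =>
          mul_le_mul_of_nonneg_left (sum_row_abs_le N hB t) (abs_nonneg _)
    _ = (∑ t ∈ Finset.Ico D N, |if u ≤ t then h (t - u) else 0|) * B := by rw [Finset.sum_mul]
    _ ≤ B * B := mul_le_mul_of_nonneg_right (sum_column_abs_le hB D N u) hB0

/-- The Frobenius norm of the energy matrix: an averaging filter of length `r` gains the factor
`1 / r` over the trivial bound. -/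
theorem sum_energyMatrix_sq_le {B c : ℝ} (hB : ∀ n, ∑ j ∈ Finset.range n, |h j| ≤ B)
    (hc : ∀ j, |h j| ≤ c) :
    ∑ p ∈ Finset.range N ×ˢ Finset.range N, energyMatrix h D N p ^ 2 ≤ N * (B * B * (c * B)) := by
  have hB0 : 0 ≤ B := by simpa using hB 0
  have hc0 : 0 ≤ c := (abs_nonneg _).trans (hc 0)
  have hsup : ∀ p, |energyMatrix h D N p| ≤ c * B := fun p => by
    refine (abs_energyMatrix_le_sum p).trans ?_
    calc _ ≤ ∑ t ∈ Finset.Ico D N, c * |if p.2 ≤ t then h (t - p.2) else 0| := by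
          refine Finset.sum_le_sum fun t _ => mul_le_mul_of_nonneg_right ?_ (abs_nonneg _)
          split_ifs
          · exact hc _
          · simpa using hc0
      _ ≤ c * B := by
          rw [← Finset.mul_sum]
          exact mul_le_mul_of_nonneg_left (sum_column_abs_le hB D N _) hc0
  rw [Finset.sum_product]
  calc ∑ u ∈ Finset.range N, ∑ v ∈ Finset.range N, energyMatrix h D N (u, v) ^ 2
      ≤ ∑ u ∈ Finset.range N, B * B * (c * B) := by
        refine Finset.sum_le_sum fun u _ => ?_
        calc ∑ v ∈ Finset.range N, energyMatrix h D N (u, v) ^ 2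
            ≤ ∑ v ∈ Finset.range N, |energyMatrix h D N (u, v)| * (c * B) := by
              refine Finset.sum_le_sum fun v _ => ?_
              rw [← sq_abs, sq]
              exact mul_le_mul_of_nonneg_left (hsup _) (abs_nonneg _)
          _ = (∑ v ∈ Finset.range N, |energyMatrix h D N (u, v)|) * (c * B) := by
              rw [Finset.sum_mul]
          _ ≤ B * B * (c * B) :=
              mul_le_mul_of_nonneg_right (sum_abs_energyMatrix_le hB u) (by positivity)
    _ = N * (B * B * (c * B)) := by simp

end Energy

/-! ### Spectral representation of the energy -/

theorem sum_mul_covariance_eq_integral {γ : ℤ → ℝ} {φ : ℝ → ℝ}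
    (hφ : IntervalIntegrable φ volume (-Real.pi) Real.pi)
    (hγ : ∀ τ : ℤ, (γ τ : ℂ) =
      ∫ θ in (-Real.pi)..Real.pi, Complex.exp (Complex.I * θ * τ) * (φ θ : ℂ))
    (N : ℕ) (x : ℕ → ℝ) :
    ∑ p ∈ Finset.range N ×ˢ Finset.range N, x p.1 * x p.2 * γ (p.2 - p.1) =
      ∫ θ in (-Real.pi)..Real.pi,
        ‖∑ u ∈ Finset.range N, (x u : ℂ) * Complex.exp (Complex.I * θ * u)‖ ^ 2 * φ θ := by
  have hint : ∀ τ : ℤ, IntervalIntegrable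
      (fun θ : ℝ => Complex.exp (Complex.I * θ * τ) * (φ θ : ℂ)) volume (-Real.pi) Real.pi :=
    fun τ => (IntervalIntegrable.continuousOn_mul ⟨hφ.1.ofReal, hφ.2.ofReal⟩ (by fun_prop))
  apply Complex.ofReal_injective
  rw [← intervalIntegral.integral_ofReal]
  have hpt : ∀ θ : ℝ, ((‖∑ u ∈ Finset.range N,
      (x u : ℂ) * Complex.exp (Complex.I * θ * u)‖ ^ 2 * φ θ : ℝ) : ℂ) =
      ∑ p ∈ Finset.range N ×ˢ Finset.range N, ((x p.1 * x p.2 : ℝ) : ℂ) *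
        (Complex.exp (Complex.I * θ * ((p.2 : ℤ) - (p.1 : ℤ) : ℤ)) * (φ θ : ℂ)) := by
    intro θ
    rw [Complex.ofReal_mul, Complex.ofReal_pow, ← Complex.conj_mul', map_sum, Finset.sum_mul_sum,
      ← Finset.sum_product', Finset.sum_mul]
    refine Finset.sum_congr rfl fun p _ => ?_
    rw [map_mul, ← Complex.exp_conj]
    simp only [map_mul, Complex.conj_I, Complex.conj_ofReal, map_natCast]
    have : Complex.exp (Complex.I * θ * ((p.2 : ℤ) - (p.1 : ℤ) : ℤ)) =
        Complex.exp (-Complex.I * θ * p.1) * Complex.exp (Complex.I * θ * p.2) := by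
      rw [← Complex.exp_add]; push_cast; ring_nf
    rw [this]; push_cast; ring
  simp_rw [hpt]
  rw [intervalIntegral.integral_finsetSum fun p _ => (hint _).const_mul _]
  push_cast
  refine Finset.sum_congr rfl fun p _ => ?_
  rw [intervalIntegral.integral_const_mul, hγ]
  push_cast
  rfl

theorem norm_sum_filter_exp {h : ℕ → ℝ} {D N : ℕ} (hD : ∀ j, D < j → h j = 0) {t : ℕ}
    (ht : t ∈ Finset.Ico D N) (θ : ℝ) :
    ‖∑ u ∈ Finset.range N, ((if u ≤ t then h (t - u) else 0 : ℝ) : ℂ) *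
        Complex.exp (Complex.I * θ * u)‖ =
      ‖∑ j ∈ Finset.range (D + 1), (h j : ℂ) * Complex.exp (-Complex.I * θ * j)‖ := by
  have := sum_filter_eq_sum_range (R := ℂ) hD (fun k : ℤ => Complex.exp (Complex.I * θ * k)) ht
  simp only [Complex.coe_algebraMap, Int.cast_natCast] at this
  rw [← this]
  have h2 : ∀ j : ℕ, Complex.exp (Complex.I * θ * (((t : ℤ) - (j : ℤ) : ℤ) : ℂ)) =
      Complex.exp (((θ * t : ℝ) : ℂ) * Complex.I) * Complex.exp (-Complex.I * θ * j) := fun j => by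
    rw [← Complex.exp_add]; push_cast; ring_nf
  simp_rw [h2, mul_left_comm _ (Complex.exp (((θ * t : ℝ) : ℂ) * Complex.I))]
  rw [← Finset.mul_sum, norm_mul, Complex.norm_exp_ofReal_mul_I, one_mul]

/-- The expected energy of the output of a causal filter, in the frequency domain. -/
theorem sum_energyMatrix_mul_covariance {γ : ℤ → ℝ} {φ : ℝ → ℝ}
    (hφ : IntervalIntegrable φ volume (-Real.pi) Real.pi)
    (hγ : ∀ τ : ℤ, (γ τ : ℂ) =
      ∫ θ in (-Real.pi)..Real.pi, Complex.exp (Complex.I * θ * τ) * (φ θ : ℂ))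
    {h : ℕ → ℝ} {D N : ℕ} (hD : ∀ j, D < j → h j = 0) :
    ∑ p ∈ Finset.range N ×ˢ Finset.range N, energyMatrix h D N p * γ (p.2 - p.1) =
      (N - D : ℕ) * ∫ θ in (-Real.pi)..Real.pi,
        ‖∑ j ∈ Finset.range (D + 1), (h j : ℂ) * Complex.exp (-Complex.I * θ * j)‖ ^ 2 * φ θ := by
  simp_rw [energyMatrix, Finset.sum_mul]
  rw [Finset.sum_comm]
  rw [Finset.sum_congr rfl fun t ht => (sum_mul_covariance_eq_integral hφ hγ N
    (fun u => if u ≤ t then h (t - u) else 0))]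
  rw [Finset.sum_congr rfl fun t ht => by simp_rw [norm_sum_filter_exp hD ht]; rfl]
  simp

/-! ### Divergence of band energies of a scalar series -/

theorem bandFilter_coeff_eq_zero {r m j : ℕ} (hj : (m + 1) * r < j) :
    (bandFilter r m).coeff j = 0 :=
  Polynomial.coeff_eq_zero_of_natDegree_lt ((bandFilter_natDegree_le r m).trans_lt hj)

/-- Nonnegative random variables with summable means tend to zero almost surely. -/
theorem ae_tendsto_zero_of_summable_integral {Ω : Type*} [MeasurableSpace Ω] {P : Measure Ω}
    {f : ℕ → Ω → ℝ} (hf : ∀ k, Integrable (f k) P) (h0 : ∀ k w, 0 ≤ f k w) {b : ℕ → ℝ}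
    (hb : Summable b) (hfb : ∀ᶠ k in atTop, ∫ w, f k w ∂P ≤ b k) :
    ∀ᵐ w ∂P, Tendsto (fun k => f k w) atTop (𝓝 0) := by
  have hs : Summable fun k => ∫ w, f k w ∂P := by
    refine Summable.of_norm_bounded_eventually_nat hb ?_
    filter_upwards [hfb] with k hk
    rwa [Real.norm_of_nonneg (integral_nonneg (h0 k))]
  have hl : ∀ k, ∫⁻ w, ENNReal.ofReal (f k w) ∂P = ENNReal.ofReal (∫ w, f k w ∂P) := fun k =>
    (ofReal_integral_eq_lintegral_ofReal (hf k) (ae_of_all _ (h0 k))).symm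
  have hm : ∀ k, AEMeasurable (fun w => ENNReal.ofReal (f k w)) P := fun k =>
    (hf k).aestronglyMeasurable.aemeasurable.ennreal_ofReal
  have hfin : ∫⁻ w, ∑' k, ENNReal.ofReal (f k w) ∂P ≠ ⊤ := by
    rw [lintegral_tsum hm]
    simp_rw [hl]
    exact hs.tsum_ofReal_ne_top
  filter_upwards [ae_lt_top' (AEMeasurable.tsum hm) hfin] with w hw
  have h := ENNReal.tendsto_atTop_zero_of_tsum_ne_top hw.ne
  have h' := (ENNReal.tendsto_toReal ENNReal.zero_ne_top).comp h
  refine (h'.congr fun k => ?_)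
  simp [ENNReal.toReal_ofReal (h0 k w)]

/-- At a Fourier frequency either the weight is at least one, or the transfer function of the
filter is negligible. -/
theorem norm_bandTransfer_sq_le {r m T s : ℕ} (hr : 0 < r) (hT : r ^ 2 ≤ T) (hT' : T < 4 * r ^ 2)
    {β : ℝ} (hm : 2 ≤ (1 - β) * m) (hs : s < T) {c : ℝ} (hc0 : 0 ≤ c)
    (hc1 : (∃ j : ℤ, |2 * Real.pi * s / T - 2 * Real.pi * j| ≤ √((T : ℝ) ^ (-β)) / 4) → 1 ≤ c) :
    ‖bandTransfer r m (2 * Real.pi * s / T)‖ ^ 2 ≤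
      (if s = 0 then 0 else 4 * c) + 4 * (8 * Real.pi) ^ (2 * m) / ((r : ℝ) ^ 2) ^ 2 := by
  have hr' : (0 : ℝ) < r := by positivity
  have hTN : 0 < T := lt_of_lt_of_le (by positivity) hT
  have hTpos : (0 : ℝ) < T := by exact_mod_cast hTN
  have hTR : (T : ℝ) < 4 * r ^ 2 := by exact_mod_cast hT'
  have hTR' : (r : ℝ) ^ 2 ≤ T := by exact_mod_cast hT
  have herr : 0 ≤ 4 * (8 * Real.pi) ^ (2 * m) / ((r : ℝ) ^ 2) ^ 2 := by positivity
  by_cases hs0 : s = 0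
  · subst hs0
    simp [bandTransfer_zero]
    positivity
  rw [if_neg hs0]
  by_cases hnear : ∃ j : ℤ, |2 * Real.pi * s / T - 2 * Real.pi * j| ≤ √((T : ℝ) ^ (-β)) / 4
  · have h1 := hc1 hnear
    have h2 := norm_bandTransfer_le_two hr m (2 * Real.pi * s / T)
    have h3 : ‖bandTransfer r m (2 * Real.pi * s / T)‖ ^ 2 ≤ 2 ^ 2 :=
      pow_le_pow_left₀ (norm_nonneg _) h2 2
    linarith
  · push Not at hnear
    -- the representative of the frequency in `[-π, π]`
    obtain ⟨j, hj⟩ : ∃ j : ℤ, |2 * Real.pi * s / T - 2 * Real.pi * j| ≤ Real.pi := by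
      have hsT : (s : ℝ) < T := by exact_mod_cast hs
      have hq1 : (s : ℝ) / T ≤ 1 := (div_le_one hTpos).2 hsT.le
      have hq0 : 0 ≤ (s : ℝ) / T := by positivity
      have hpi := Real.pi_pos
      have heq : 2 * Real.pi * s / T = 2 * Real.pi * (s / T) := by ring
      rcases le_total ((s : ℝ) / T) (1 / 2) with h | h
      · refine ⟨0, ?_⟩
        rw [heq, abs_le]
        constructor <;> push_cast <;> nlinarith
      · refine ⟨1, ?_⟩
        rw [heq, abs_le]
        constructor <;> push_cast <;> nlinarith
    set θ := 2 * Real.pi * s / T - 2 * Real.pi * j with hθ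
    have hfar := hnear j
    rw [← hθ] at hfar
    have hBpos : 0 < √((T : ℝ) ^ (-β)) := Real.sqrt_pos.2 (Real.rpow_pos_of_pos hTpos _)
    have hθpos : 0 < |θ| := lt_trans (by positivity) hfar
    have hper : bandTransfer r m (2 * Real.pi * s / T) = bandTransfer r m θ := by
      rw [← bandTransfer_add_two_pi r m θ j, hθ, sub_add_cancel]
    have hmain := norm_bandTransfer_le hr m (abs_pos.1 hθpos) hj
    rw [hper]
    -- `r ≥ √T / 2` and `|θ| > √B / 4`, where `√T √B = T ^ ((1 - β) / 2)`
    have hbase : Real.pi / (r * |θ|) ≤ 8 * Real.pi * (T : ℝ) ^ (-((1 - β) / 2)) := by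
      have hr2 : √(T : ℝ) ≤ 2 * r := by
        rw [Real.sqrt_le_left (by positivity)]; nlinarith
      have hpow : √(T : ℝ) * √((T : ℝ) ^ (-β)) = (T : ℝ) ^ ((1 - β) / 2) := by
        rw [Real.sqrt_eq_rpow, Real.sqrt_eq_rpow, ← Real.rpow_mul hTpos.le, ← Real.rpow_add hTpos]
        congr 1; ring
      have hlow : (T : ℝ) ^ ((1 - β) / 2) ≤ 8 * (r * |θ|) := by
        rw [← hpow]
        calc √(T : ℝ) * √((T : ℝ) ^ (-β)) ≤ (2 * r) * (4 * |θ|) := by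
              refine mul_le_mul hr2 (by linarith) hBpos.le (by positivity)
          _ = 8 * (r * |θ|) := by ring
      rw [Real.rpow_neg hTpos.le, div_le_iff₀ (by positivity)]
      have hp : 0 < (T : ℝ) ^ ((1 - β) / 2) := Real.rpow_pos_of_pos hTpos _
      have hpi := Real.pi_pos
      calc Real.pi = Real.pi * ((T : ℝ) ^ ((1 - β) / 2))⁻¹ * (T : ℝ) ^ ((1 - β) / 2) := by
            field_simp
        _ ≤ Real.pi * ((T : ℝ) ^ ((1 - β) / 2))⁻¹ * (8 * (r * |θ|)) := by gcongr
        _ = _ := by ring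
    have hT1 : (1 : ℝ) ≤ T := by exact_mod_cast hTN
    calc ‖bandTransfer r m θ‖ ^ 2 ≤ (2 * (Real.pi / (r * |θ|)) ^ m) ^ 2 :=
          pow_le_pow_left₀ (norm_nonneg _) hmain 2
      _ ≤ (2 * (8 * Real.pi * (T : ℝ) ^ (-((1 - β) / 2))) ^ m) ^ 2 := by
          gcongr
      _ = 4 * (8 * Real.pi) ^ (2 * m) * (T : ℝ) ^ (-((1 - β) * m)) := by
          rw [mul_pow (8 * Real.pi), ← Real.rpow_natCast ((T : ℝ) ^ _) m, ← Real.rpow_mul hTpos.le,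
            mul_pow, mul_pow, ← Real.rpow_natCast ((T : ℝ) ^ _) 2, ← Real.rpow_mul hTpos.le,
            ← pow_mul, mul_comm m 2]
          have : -((1 - β) / 2) * (m : ℝ) * ((2 : ℕ) : ℝ) = -((1 - β) * m) := by push_cast; ring
          rw [this]; ring
      _ ≤ 4 * (8 * Real.pi) ^ (2 * m) * (T : ℝ) ^ (-2 : ℝ) := by
          gcongr
      _ ≤ 4 * (8 * Real.pi) ^ (2 * m) / ((r : ℝ) ^ 2) ^ 2 := by
          rw [Real.rpow_neg hTpos.le, ← div_eq_mul_inv, Real.rpow_two]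
          gcongr
      _ ≤ _ := by linarith

/-- The weighted energy of a sample at the Fourier frequencies dominates the energy of the
filtered series, which does not involve the sample size. -/
theorem filtered_energy_le {r m T : ℕ} (hr : 0 < r) (hT : r ^ 2 ≤ T)
    (hT' : T < 4 * r ^ 2) {β : ℝ} (hm : 2 ≤ (1 - β) * m) {c : ℕ → ℝ} (hc0 : ∀ s, 0 ≤ c s)
    (hc1 : ∀ s < T, (∃ j : ℤ, |2 * Real.pi * s / T - 2 * Real.pi * j| ≤
      √((T : ℝ) ^ (-β)) / 4) → 1 ≤ c s) (y : ℤ → ℝ) :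
    ∑ p ∈ Finset.range (r ^ 2) ×ˢ Finset.range (r ^ 2),
        energyMatrix (bandFilter r m).coeff ((m + 1) * r) (r ^ 2) p * (y p.1 * y p.2) ≤
      8 * r * (1 / (T * √T) * ∑ s ∈ Finset.Icc 1 (T - 1), c s *
        ‖∑ t ∈ Finset.range T, (y t : ℂ) *
          Complex.exp (-Complex.I * (2 * Real.pi * s / T) * t)‖ ^ 2) +
      4 * (8 * Real.pi) ^ (2 * m) *
        (1 / ((r : ℝ) ^ 2) ^ 2 * ∑ t ∈ Finset.range (4 * r ^ 2), y t ^ 2) := by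
  have hTN : 0 < T := lt_of_lt_of_le (by positivity) hT
  have hTpos : (0 : ℝ) < T := by exact_mod_cast hTN
  have hTR : (T : ℝ) < 4 * r ^ 2 := by exact_mod_cast hT'
  set D := (m + 1) * r
  set g := (bandFilter r m).coeff
  set Z : ℕ → ℝ := fun s => ‖∑ t ∈ Finset.range T, (y t : ℂ) *
          Complex.exp (-Complex.I * (2 * Real.pi * s / T) * t)‖ ^ 2 with hZ
  set e := 4 * (8 * Real.pi) ^ (2 * m) / ((r : ℝ) ^ 2) ^ 2 with he
  have hpars : ∑ s ∈ Finset.range T, Z s = T * ∑ t ∈ Finset.range T, y t ^ 2 := by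
    have := sum_norm_sq_finite_fourier hTN (fun t : ℕ => (y t : ℂ))
    simp only [Complex.norm_real, Real.norm_eq_abs, sq_abs] at this
    exact this
  have hcirc := sum_sq_filter_le (D := D) hTN g y
  have hG : ∀ s : ℕ, ∑ j ∈ Finset.range (D + 1), (g j : ℂ) *
      Complex.exp (-Complex.I * (2 * Real.pi * s / T) * j) =
      bandTransfer r m (2 * Real.pi * s / T) := fun s => by
    simp [bandTransfer, D, g]
  have h1 : ∑ t ∈ Finset.Ico D (r ^ 2), (∑ j ∈ Finset.range (D + 1), g j * y ((t : ℤ) - j)) ^ 2 ≤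
      ∑ t ∈ Finset.Ico D T, (∑ j ∈ Finset.range (D + 1), g j * y ((t : ℤ) - j)) ^ 2 :=
    Finset.sum_le_sum_of_subset_of_nonneg (Finset.Ico_subset_Ico_right hT)
      fun _ _ _ => sq_nonneg _
  rw [← sum_sq_filter_eq (fun j hj => bandFilter_coeff_eq_zero hj)]
  have h2 : ∑ s ∈ Finset.range T, ‖bandTransfer r m (2 * Real.pi * s / T)‖ ^ 2 * Z s ≤
      4 * (∑ s ∈ Finset.Icc 1 (T - 1), c s * Z s) + e * (T * ∑ t ∈ Finset.range T, y t ^ 2) := by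
    calc _ ≤ ∑ s ∈ Finset.range T, ((if s = 0 then 0 else 4 * c s) + e) * Z s :=
          Finset.sum_le_sum fun s hs => mul_le_mul_of_nonneg_right
            (norm_bandTransfer_sq_le hr hT hT' hm (Finset.mem_range.1 hs) (hc0 s)
              (hc1 s (Finset.mem_range.1 hs))) (by positivity)
      _ = ∑ s ∈ Finset.range T, (if s = 0 then 0 else 4 * (c s * Z s)) +
            e * ∑ s ∈ Finset.range T, Z s := by
          rw [Finset.mul_sum, ← Finset.sum_add_distrib]
          refine Finset.sum_congr rfl fun s _ => ?_
          split_ifs <;> ring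
      _ = _ := by
          rw [hpars]
          congr 1
          have : Finset.Icc 1 (T - 1) ⊆ Finset.range T := fun s hs => by
            simp at hs ⊢; omega
          rw [← Finset.sum_subset this, Finset.mul_sum]
          · refine Finset.sum_congr rfl fun s hs => ?_
            rw [if_neg (by simp at hs; omega)]
          · intro s hs hs'
            rw [if_pos (by simp at hs hs'; omega)]
  have hQ0 : 0 ≤ ∑ s ∈ Finset.Icc 1 (T - 1), c s * Z s :=
    Finset.sum_nonneg fun s _ => mul_nonneg (hc0 s) (by positivity)
  simp_rw [hG] at hcirc
  have h3 := hcirc.trans h2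
  have h4 : ∑ t ∈ Finset.Ico D T, (∑ j ∈ Finset.range (D + 1), g j * y ((t : ℤ) - j)) ^ 2 ≤
      4 * (1 / T * ∑ s ∈ Finset.Icc 1 (T - 1), c s * Z s) + e * ∑ t ∈ Finset.range T, y t ^ 2 := by
    refine le_of_mul_le_mul_left (h3.trans (le_of_eq ?_)) hTpos
    field_simp
  refine (h1.trans h4).trans (add_le_add ?_ ?_)
  · have hr2 : √(T : ℝ) ≤ 2 * r := by
      rw [Real.sqrt_le_left (by positivity)]; nlinarith
    have hsq : 0 < √(T : ℝ) := Real.sqrt_pos.2 hTpos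
    have heq : 1 / (T : ℝ) * ∑ s ∈ Finset.Icc 1 (T - 1), c s * Z s =
        √T * (1 / (T * √T) * ∑ s ∈ Finset.Icc 1 (T - 1), c s * Z s) := by
      field_simp
    rw [heq]
    have hnn : 0 ≤ 1 / (T * √T) * ∑ s ∈ Finset.Icc 1 (T - 1), c s * Z s := by positivity
    nlinarith
  · rw [he, div_eq_mul_one_div, mul_assoc]
    gcongr

/-- The power of the filtered series, for a spectral density with a pole of order `l`. -/
theorem le_integral_bandTransfer {φ : ℝ → ℝ}
    (hφ : IntervalIntegrable φ volume (-Real.pi) Real.pi)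
    (hφ0 : ∀ θ ∈ Set.Icc (-Real.pi) Real.pi, 0 ≤ φ θ) {c l : ℝ} (hc : 0 < c) (hl : 0 < l)
    (hlow : ∀ θ ∈ Set.Ioc (0 : ℝ) 1, c * θ ^ (-l) ≤ φ θ) {r : ℕ} (hr : 0 < r) (m : ℕ) :
    c * ((1 / 2) ^ m * (1 / Real.pi)) ^ 2 / 2 * ((r : ℝ) ^ l / r) ≤
      ∫ θ in (-Real.pi)..Real.pi, ‖bandTransfer r m θ‖ ^ 2 * φ θ := by
  have hr' : (0 : ℝ) < r := by positivity
  have hr1 : (1 : ℝ) ≤ r := by exact_mod_cast hr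
  have hpi := Real.pi_gt_three
  set b := ((1 / 2 : ℝ) ^ m * (1 / Real.pi)) ^ 2 with hb
  have hcont : Continuous fun θ => ‖bandTransfer r m θ‖ ^ 2 := by
    unfold bandTransfer; fun_prop
  have hint : IntervalIntegrable (fun θ => ‖bandTransfer r m θ‖ ^ 2 * φ θ) volume
      (-Real.pi) Real.pi := hφ.continuousOn_mul hcont.continuousOn
  have hu : 1 / (r : ℝ) ≤ 1 := (div_le_one hr').2 hr1
  have hd : 1 / (2 * (r : ℝ)) = 1 / r / 2 := by field_simp
  have h0 : 0 < 1 / (2 * (r : ℝ)) := by positivity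
  have hle : 1 / (2 * (r : ℝ)) ≤ 1 / r := by rw [hd]; linarith
  calc c * b / 2 * ((r : ℝ) ^ l / r)
      = ∫ θ in (1 / (2 * (r : ℝ)))..(1 / r), b * (c * (r : ℝ) ^ l) := by
        rw [intervalIntegral.integral_const, hd, smul_eq_mul]; field_simp; ring
    _ ≤ ∫ θ in (1 / (2 * (r : ℝ)))..(1 / r), ‖bandTransfer r m θ‖ ^ 2 * φ θ := by
        refine intervalIntegral.integral_mono_on hle (by simp) (hint.mono_set ?_) ?_
        · rw [Set.uIcc_of_le hle, Set.uIcc_of_le (by linarith)]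
          exact Set.Icc_subset_Icc (by linarith) (by linarith)
        · intro θ hθ
          have hθ0 : 0 < θ := h0.trans_le hθ.1
          refine mul_le_mul
            (pow_le_pow_left₀ (by positivity) (le_norm_bandTransfer hr m hθ.1 hθ.2) 2)
            (le_trans ?_ (hlow θ ⟨hθ0, hθ.2.trans hu⟩)) (by positivity) (by positivity)
          refine mul_le_mul_of_nonneg_left ?_ hc.le
          rw [Real.rpow_neg hθ0.le, ← Real.inv_rpow hθ0.le]
          refine Real.rpow_le_rpow hr'.le ?_ hl.le
          rw [le_inv_comm₀ hr' hθ0, ← one_div]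
          exact hθ.2
    _ ≤ ∫ θ in (-Real.pi)..Real.pi, ‖bandTransfer r m θ‖ ^ 2 * φ θ := by
        refine intervalIntegral.integral_mono_interval (by linarith) hle (by linarith) ?_ hint
        refine (ae_restrict_iff' measurableSet_Ioc).2 (ae_of_all _ fun θ hθ => ?_)
        exact mul_nonneg (by positivity) (hφ0 θ (Set.Ioc_subset_Icc_self hθ))

/-- The energy matrix of the band pass filter with averages over `r` times and a sample of size
`r ^ 2`. -/
noncomputable def bandEnergyMatrix (r m : ℕ) : ℕ × ℕ → ℝ :=
  energyMatrix (bandFilter r m).coeff ((m + 1) * r) (r ^ 2)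

/-- The mean energy in the pass band is at least of order `r ^ (1 + l)`. -/
theorem le_mean_bandEnergy {γ : ℤ → ℝ} {φ : ℝ → ℝ}
    (hφ : IntervalIntegrable φ volume (-Real.pi) Real.pi)
    (hγ : ∀ τ : ℤ, (γ τ : ℂ) =
      ∫ θ in (-Real.pi)..Real.pi, Complex.exp (Complex.I * θ * τ) * (φ θ : ℂ))
    (hφ0 : ∀ θ ∈ Set.Icc (-Real.pi) Real.pi, 0 ≤ φ θ) {c l : ℝ} (hc : 0 < c) (hl : 0 < l)
    (hlow : ∀ θ ∈ Set.Ioc (0 : ℝ) 1, c * θ ^ (-l) ≤ φ θ) {r m : ℕ} (hr : 0 < r)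
    (hrm : 2 * (m + 1) ≤ r) :
    c * ((1 / 2) ^ m * (1 / Real.pi)) ^ 2 / 4 * ((r : ℝ) * (r : ℝ) ^ l) ≤
      ∑ p ∈ Finset.range (r ^ 2) ×ˢ Finset.range (r ^ 2),
        bandEnergyMatrix r m p * γ (p.2 - p.1) := by
  have hrR : (0 : ℝ) < r := by exact_mod_cast hr
  unfold bandEnergyMatrix
  rw [sum_energyMatrix_mul_covariance hφ hγ fun j hj => bandFilter_coeff_eq_zero hj]
  have hint := le_integral_bandTransfer hφ hφ0 hc hl hlow hr m
  have hrmR : (2 * (m + 1) : ℝ) ≤ r := by exact_mod_cast hrm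
  have hsub : (r : ℝ) ^ 2 / 2 ≤ (r ^ 2 - (m + 1) * r : ℕ) := by
    rw [Nat.cast_sub (by nlinarith)]
    push_cast
    nlinarith
  have hrl : 0 < (r : ℝ) ^ l := Real.rpow_pos_of_pos hrR _
  refine le_trans (le_of_eq ?_) (mul_le_mul hsub hint (by positivity) (by positivity))
  field_simp
  ring

section Concentration

variable {Ω : Type*} [MeasurableSpace Ω] {P : Measure Ω} [IsProbabilityMeasure P] {Y : ℤ → Ω → ℝ}

theorem integrable_quadratic_form_div_sub_one_sq (hY : ∀ t, MemLp (Y t) 4 P) (N : ℕ)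
    (a : ℕ × ℕ → ℝ) (μ : ℝ) :
    Integrable (fun w => ((∑ p ∈ Finset.range N ×ˢ Finset.range N,
      a p * (Y p.1 w * Y p.2 w)) / μ - 1) ^ 2) P := by
  have hmem : MemLp (fun w => ∑ p ∈ Finset.range N ×ˢ Finset.range N,
      a p * (Y p.1 w * Y p.2 w)) 2 P :=
    memLp_finsetSum _ fun p _ => ((hY p.1).mul_four_two (hY p.2)).const_mul _
  have : MemLp (fun w => (∑ p ∈ Finset.range N ×ˢ Finset.range N,
      a p * (Y p.1 w * Y p.2 w)) / μ - 1) 2 P := by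
    refine ((hmem.const_mul μ⁻¹).sub (memLp_const (1 : ℝ))).ae_eq (ae_of_all _ fun w => ?_)
    simp [div_eq_inv_mul]
  exact this.integrable_sq

/-- The energy in the pass band has a variance of the order of the sample size `r ^ 2`. -/
theorem integral_bandEnergy_sub_sq_le (hY : ∀ t, MemLp (Y t) 4 P) {γ : ℤ → ℝ}
    (h2 : ∀ s t : ℤ, ∫ w, Y s w * Y t w ∂P = γ (t - s)) {κ : ℤ → ℤ → ℤ → ℤ → ℝ}
    (h4 : ∀ a b c e : ℤ, ∫ w, Y a w * Y b w * (Y c w * Y e w) ∂P =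
      γ (b - a) * γ (e - c) + γ (c - a) * γ (e - b) + γ (e - a) * γ (c - b) + κ a b c e)
    (hγ2 : Summable fun τ => γ τ ^ 2) {K : ℝ}
    (hκ : ∀ N : ℕ, ∑ p ∈ Finset.range N ×ˢ Finset.range N,
      ∑ q ∈ Finset.range N ×ˢ Finset.range N, κ p.1 p.2 q.1 q.2 ^ 2 ≤ N * K)
    {r m : ℕ} (hr : 0 < r) (hm : 1 ≤ m) :
    ∫ w, ((∑ p ∈ Finset.range (r ^ 2) ×ˢ Finset.range (r ^ 2),
        bandEnergyMatrix r m p * (Y p.1 w * Y p.2 w)) -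
      ∑ p ∈ Finset.range (r ^ 2) ×ˢ Finset.range (r ^ 2),
        bandEnergyMatrix r m p * γ (p.2 - p.1)) ^ 2 ∂P ≤
      (32 * (∑' τ, γ τ ^ 2) + 8 * √K) * (r : ℝ) ^ 2 := by
  have hrR : (0 : ℝ) < r := by exact_mod_cast hr
  obtain ⟨m', rfl⟩ : ∃ m', m = m' + 1 := ⟨m - 1, by omega⟩
  have hB := bandFilter_sum_abs_coeff_le hr (m' + 1)
  have := integral_quadratic_form_sub_sq_le (P := P) (Y := fun t : ℕ => Y t)
    (κ := fun a b c e : ℕ => κ a b c e) (fun t => hY t)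
    (fun s t => h2 s t) (fun a b c e => h4 a b c e) hγ2 (hκ (r ^ 2))
    (a := bandEnergyMatrix r (m' + 1))
    (energyMatrix_symm _ _ _) (fun u => sum_abs_energyMatrix_le hB u)
    (sum_energyMatrix_sq_le hB (bandFilter_abs_coeff_le hr m'))
  refine this.trans (le_of_eq ?_)
  push_cast
  rw [Real.sqrt_mul (by positivity), Real.sqrt_sq hrR.le]
  field_simp
  ring

/-- Along the samples of size `4 ^ k`, the energy in the pass band is asymptotic to its mean. -/
theorem ae_tendsto_bandEnergy_div_mean (hY : ∀ t, MemLp (Y t) 4 P) {γ : ℤ → ℝ}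
    (h2 : ∀ s t : ℤ, ∫ w, Y s w * Y t w ∂P = γ (t - s)) {κ : ℤ → ℤ → ℤ → ℤ → ℝ}
    (h4 : ∀ a b c e : ℤ, ∫ w, Y a w * Y b w * (Y c w * Y e w) ∂P =
      γ (b - a) * γ (e - c) + γ (c - a) * γ (e - b) + γ (e - a) * γ (c - b) + κ a b c e)
    (hγ2 : Summable fun τ => γ τ ^ 2) {K : ℝ}
    (hκ : ∀ N : ℕ, ∑ p ∈ Finset.range N ×ˢ Finset.range N,
      ∑ q ∈ Finset.range N ×ˢ Finset.range N, κ p.1 p.2 q.1 q.2 ^ 2 ≤ N * K)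
    {m : ℕ} (hm : 1 ≤ m) {c l : ℝ} (hc : 0 < c) (hl : 0 < l) {r : ℕ → ℕ} (hr : ∀ k, r k = 2 ^ k)
    {μ : ℕ → ℝ} (hμ : ∀ k, μ k = ∑ p ∈ Finset.range (r k ^ 2) ×ˢ Finset.range (r k ^ 2),
      bandEnergyMatrix (r k) m p * γ (p.2 - p.1))
    (hμlow : ∀ᶠ k in atTop, c * ((r k : ℝ) * (r k : ℝ) ^ l) ≤ μ k) :
    ∀ᵐ w ∂P, Tendsto (fun k => ((∑ p ∈ Finset.range (r k ^ 2) ×ˢ Finset.range (r k ^ 2),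
        bandEnergyMatrix (r k) m p * (Y p.1 w * Y p.2 w)) / μ k - 1) ^ 2) atTop (𝓝 0) := by
  set C := 32 * (∑' τ, γ τ ^ 2) + 8 * √K with hC
  have hCnn : 0 ≤ C := by positivity
  have hq : (2 : ℝ) ^ (-(2 * l)) < 1 :=
    Real.rpow_lt_one_of_one_lt_of_neg one_lt_two (by linarith)
  refine ae_tendsto_zero_of_summable_integral
    (fun k => integrable_quadratic_form_div_sub_one_sq hY _ _ _) (fun k w => sq_nonneg _)
    (b := fun k => C / c ^ 2 * ((2 : ℝ) ^ (-(2 * l))) ^ k)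
    ((summable_geometric_of_lt_one (by positivity) hq).mul_left _) ?_
  filter_upwards [hμlow] with k hk
  have hrk0 : 0 < r k := by rw [hr]; positivity
  have hrk : (0 : ℝ) < r k := by exact_mod_cast hrk0
  have hrl : 0 < (r k : ℝ) ^ l := Real.rpow_pos_of_pos hrk _
  have hμpos : 0 < μ k := lt_of_lt_of_le (by positivity) hk
  have hvar := integral_bandEnergy_sub_sq_le hY h2 h4 hγ2 hκ hrk0 hm
  rw [← hμ k] at hvar
  have hdiv : ∀ x : ℝ, (x / μ k - 1) ^ 2 = (x - μ k) ^ 2 / μ k ^ 2 := fun x => by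
    field_simp
  simp_rw [hdiv]
  rw [integral_div]
  have hpow : ((2 : ℝ) ^ (-(2 * l))) ^ k = 1 / ((r k : ℝ) ^ l) ^ 2 := by
    rw [← Real.rpow_natCast, ← Real.rpow_mul two_pos.le, ← Real.rpow_natCast ((r k : ℝ) ^ l),
      ← Real.rpow_mul hrk.le, one_div, ← Real.rpow_neg hrk.le, hr]
    push_cast
    rw [← Real.rpow_natCast, ← Real.rpow_mul two_pos.le]
    congr 1; ring
  rw [hpow]
  calc _ ≤ C * (r k : ℝ) ^ 2 / (c * ((r k : ℝ) * (r k : ℝ) ^ l)) ^ 2 := by gcongr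
    _ = _ := by field_simp

/-- The total energy grows linearly, hence is negligible at the scale of the squared sample
size. -/
theorem ae_tendsto_total_energy_zero (hY : ∀ t, MemLp (Y t) 4 P) {γ : ℤ → ℝ}
    (h2 : ∀ s t : ℤ, ∫ w, Y s w * Y t w ∂P = γ (t - s)) {r : ℕ → ℕ} (hr : ∀ k, r k = 2 ^ k) :
    ∀ᵐ w ∂P, Tendsto (fun k => 1 / ((r k : ℝ) ^ 2) ^ 2 *
      ∑ t ∈ Finset.range (4 * r k ^ 2), Y t w ^ 2) atTop (𝓝 0) := by
  have hYsq : ∀ t : ℤ, ∫ w, Y t w ^ 2 ∂P = γ 0 := fun t => by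
    have := h2 t t
    simp_rw [sub_self, ← sq] at this
    exact this
  have hYint : ∀ t : ℤ, Integrable (fun w => Y t w ^ 2) P := fun t =>
    ((hY t).mono_exponent (by norm_num)).integrable_sq
  refine ae_tendsto_zero_of_summable_integral
    (fun k => (integrable_finsetSum _ fun t _ => hYint (t : ℕ)).const_mul _)
    (fun k w => by positivity)
    (b := fun k => 4 * γ 0 * (1 / 4) ^ k)
    ((summable_geometric_of_lt_one (by norm_num) (by norm_num)).mul_left _)
    (Eventually.of_forall fun k => le_of_eq ?_)
  rw [integral_const_mul, integral_finsetSum _ fun t _ => hYint (t : ℕ)]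
  simp_rw [hYsq]
  have h4k : (1 / 4 : ℝ) ^ k = 1 / (r k : ℝ) ^ 2 := by
    rw [hr]; push_cast
    rw [← pow_mul, mul_comm, pow_mul, one_div_pow]; norm_num
  rw [h4k]
  have : (r k : ℝ) ≠ 0 := by rw [hr]; positivity
  simp
  field_simp

/-- The weighted energy at the low Fourier frequencies diverges almost surely, for a scalar series
whose spectral density has a pole at zero. -/
theorem ae_tendsto_atTop_weighted_energy (hY : ∀ t, MemLp (Y t) 4 P) {γ : ℤ → ℝ}
    (h2 : ∀ s t : ℤ, ∫ w, Y s w * Y t w ∂P = γ (t - s)) {κ : ℤ → ℤ → ℤ → ℤ → ℝ}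
    (h4 : ∀ a b c e : ℤ, ∫ w, Y a w * Y b w * (Y c w * Y e w) ∂P =
      γ (b - a) * γ (e - c) + γ (c - a) * γ (e - b) + γ (e - a) * γ (c - b) + κ a b c e)
    (hγ2 : Summable fun τ => γ τ ^ 2) {K : ℝ}
    (hκ : ∀ N : ℕ, ∑ p ∈ Finset.range N ×ˢ Finset.range N,
      ∑ q ∈ Finset.range N ×ˢ Finset.range N, κ p.1 p.2 q.1 q.2 ^ 2 ≤ N * K)
    {φ : ℝ → ℝ} (hφ : IntervalIntegrable φ volume (-Real.pi) Real.pi)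
    (hγ : ∀ τ : ℤ, (γ τ : ℂ) =
      ∫ θ in (-Real.pi)..Real.pi, Complex.exp (Complex.I * θ * τ) * (φ θ : ℂ))
    (hφ0 : ∀ θ ∈ Set.Icc (-Real.pi) Real.pi, 0 ≤ φ θ) {c l : ℝ} (hc : 0 < c) (hl : 0 < l)
    (hlow : ∀ θ ∈ Set.Ioc (0 : ℝ) 1, c * θ ^ (-l) ≤ φ θ)
    {β : ℝ} (hβ : β < 1) {a : ℕ → ℕ → ℝ} (ha0 : ∀ᶠ T in atTop, ∀ s, 0 ≤ a T s)
    (ha1 : ∀ᶠ T : ℕ in atTop, ∀ s < T, (∃ j : ℤ, |2 * Real.pi * s / T - 2 * Real.pi * j| ≤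
      √((T : ℝ) ^ (-β)) / 4) → 1 ≤ a T s) :
    ∀ᵐ w ∂P, Tendsto (fun T : ℕ => 1 / (T * √T) * ∑ s ∈ Finset.Icc 1 (T - 1), a T s *
        ‖∑ t ∈ Finset.range T, (Y t w : ℂ) *
          Complex.exp (-Complex.I * (2 * Real.pi * s / T) * t)‖ ^ 2) atTop atTop := by
  -- the order of the filter is chosen so that its side lobes are below `T⁻²`
  obtain ⟨m, hm, hm1⟩ : ∃ m : ℕ, 2 ≤ (1 - β) * m ∧ 1 ≤ m := by
    obtain ⟨m, hm⟩ := exists_nat_ge (2 / (1 - β))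
    rw [div_le_iff₀ (by linarith)] at hm
    refine ⟨m, by linarith, ?_⟩
    rcases Nat.eq_zero_or_pos m with h | h
    · subst h; norm_num at hm
    · exact h
  obtain ⟨r, hr⟩ : ∃ r : ℕ → ℕ, ∀ k, r k = 2 ^ k := ⟨_, fun _ => rfl⟩
  have hrpos : ∀ k, 0 < r k := fun k => by rw [hr]; positivity
  have hrR : ∀ k, (0 : ℝ) < r k := fun k => by exact_mod_cast hrpos k
  have hrtop : Tendsto (fun k => (r k : ℝ)) atTop atTop := by
    simp only [hr, Nat.cast_pow, Nat.cast_ofNat]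
    exact tendsto_pow_atTop_atTop_of_one_lt one_lt_two
  obtain ⟨μ, hμ⟩ : ∃ μ : ℕ → ℝ, ∀ k, μ k =
      ∑ p ∈ Finset.range (r k ^ 2) ×ˢ Finset.range (r k ^ 2),
        bandEnergyMatrix (r k) m p * γ (p.2 - p.1) := ⟨_, fun _ => rfl⟩
  obtain ⟨c₁, hc₁pos, hμlow⟩ : ∃ c₁ : ℝ, 0 < c₁ ∧
      ∀ᶠ k in atTop, c₁ * ((r k : ℝ) * (r k : ℝ) ^ l) ≤ μ k := by
    refine ⟨c * ((1 / 2) ^ m * (1 / Real.pi)) ^ 2 / 4, by positivity, ?_⟩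
    filter_upwards [hrtop.eventually_ge_atTop (2 * (m + 1))] with k hk
    rw [hμ]
    exact le_mean_bandEnergy hφ hγ hφ0 hc hl hlow (hrpos k) (by exact_mod_cast hk)
  filter_upwards [ae_tendsto_total_energy_zero hY h2 hr,
    ae_tendsto_bandEnergy_div_mean hY h2 h4 hγ2 hκ hm1 hc₁pos hl hr hμ hμlow] with w hw1 hw2
  set C₀ := 4 * (8 * Real.pi) ^ (2 * m) with hC₀
  have hC₀pos : 0 < C₀ := by positivity
  have hlog : Tendsto (fun T : ℕ => Nat.log 4 T) atTop atTop :=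
    tendsto_atTop.2 fun k => (eventually_ge_atTop (4 ^ k)).mono fun T hT =>
      Nat.le_log_of_pow_le (by norm_num) hT
  have hk : ∀ᶠ k in atTop, c₁ / 2 * ((r k : ℝ) * (r k : ℝ) ^ l) - C₀ ≤
      (∑ p ∈ Finset.range (r k ^ 2) ×ˢ Finset.range (r k ^ 2),
        bandEnergyMatrix (r k) m p * (Y p.1 w * Y p.2 w)) - C₀ * (1 / ((r k : ℝ) ^ 2) ^ 2 *
      ∑ t ∈ Finset.range (4 * r k ^ 2), Y t w ^ 2) := by
    filter_upwards [hμlow, hw1.eventually_le_const one_pos,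
      hw2.eventually_le_const (show (0 : ℝ) < (1 / 2) ^ 2 by norm_num)] with k h1 h2 h3
    have hrl : 0 < (r k : ℝ) ^ l := Real.rpow_pos_of_pos (hrR k) _
    have hrk := hrR k
    have hμpos : 0 < μ k := lt_of_lt_of_le (by positivity) h1
    have h5 := (abs_le_of_sq_le_sq' h3 (by norm_num)).1
    have h6 : 1 / 2 ≤ (∑ p ∈ Finset.range (r k ^ 2) ×ˢ Finset.range (r k ^ 2),
        bandEnergyMatrix (r k) m p * (Y p.1 w * Y p.2 w)) / μ k := by linarith
    rw [le_div_iff₀ hμpos] at h6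
    have h7 := mul_le_mul_of_nonneg_left h2 hC₀pos.le
    linarith
  have hlim : Tendsto (fun k => c₁ / 16 * (r k : ℝ) ^ l - C₀) atTop atTop := by
    refine tendsto_atTop_add_const_right _ _ (Tendsto.const_mul_atTop (by positivity) ?_)
    exact (tendsto_rpow_atTop hl).comp hrtop
  refine tendsto_atTop_mono' _ ?_ (hlim.comp hlog)
  filter_upwards [hlog.eventually hk, ha0, ha1, eventually_ge_atTop 1] with T hkT h0 h1 hT1
  simp only [Function.comp_apply]
  generalize hkdef : Nat.log 4 T = k at hkT ⊢
  have hrk2 : r k ^ 2 = 4 ^ k := by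
    rw [hr, ← pow_mul, mul_comm, pow_mul]; norm_num
  have hT : r k ^ 2 ≤ T := by rw [hrk2, ← hkdef]; exact Nat.pow_log_le_self 4 (by omega)
  have hT' : T < 4 * r k ^ 2 := by
    rw [hrk2, ← pow_succ', ← hkdef]; exact Nat.lt_pow_succ_log_self (by norm_num) T
  have hmain := filtered_energy_le (hrpos k) hT hT' hm h0 h1 (fun t => Y t w)
  rw [← hC₀] at hmain
  have hrk := hrR k
  have hr1 : (1 : ℝ) ≤ r k := by exact_mod_cast hrpos k
  refine le_of_mul_le_mul_left ?_ (show (0 : ℝ) < 8 * r k by positivity)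
  refine le_trans ?_ (sub_le_iff_le_add.2 hmain)
  refine le_trans ?_ hkT
  nlinarith

end Concentration

/-! ### The weights of the test statistic -/

section Weights

variable {W : ℝ → ℝ}

theorem IsWeightFunction.integrable (hW : IsWeightFunction W) : Integrable W := by
  by_contra h
  have := hW.integral_eq_one
  rw [integral_undef h] at this
  exact zero_ne_one this

/-- In the range of arguments that occur, at most the shifts by `0` and `±2π` contribute. -/
theorem IsWeightFunction.periodizedWeight_eq_sum (hW : IsWeightFunction W) {B x : ℝ} (hB : 0 < B)
    (hB1 : B ≤ 1 / 16) (hx : |x| ≤ 7) :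
    periodizedWeight W B x =
      ∑ j ∈ Finset.Icc (-1 : ℤ) 1, 1 / B * W ((x + 2 * Real.pi * j) / B) := by
  refine tsum_eq_sum fun j hj => ?_
  rw [hW.eq_zero, mul_zero]
  rw [abs_div, abs_of_pos hB, one_le_div hB]
  have hj2 : 2 ≤ |(j : ℝ)| := by
    have : 2 ≤ |j| := by
      by_contra hlt
      push Not at hlt
      have := abs_lt.1 hlt
      exact hj (Finset.mem_Icc.2 ⟨by omega, by omega⟩)
    exact_mod_cast this
  have h1 : 2 * Real.pi * |(j : ℝ)| ≤ |x + 2 * Real.pi * j| + |x| := by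
    have : |2 * Real.pi * (j : ℝ)| = 2 * Real.pi * |(j : ℝ)| := by
      rw [abs_mul, abs_of_pos Real.two_pi_pos]
    rw [← this]
    calc |2 * Real.pi * (j : ℝ)| = |(x + 2 * Real.pi * j) - x| := by ring_nf
      _ ≤ _ := abs_sub _ _
  have := Real.pi_gt_three
  nlinarith

variable {B η : ℝ}

theorem abs_sub_le_seven (hB1 : B ≤ 1 / 16) (h0 : 0 ≤ η) (h1 : η ≤ 2 * Real.pi) {θ : ℝ}
    (hθ : θ ∈ Set.uIcc (-√B / 2) (√B / 2)) : |θ - η| ≤ 7 := by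
  have hs : √B ≤ 1 / 4 := by
    rw [Real.sqrt_le_left (by norm_num)]; norm_num; linarith
  have hs0 := Real.sqrt_nonneg B
  rw [Set.uIcc_of_le (by linarith)] at hθ
  have := Real.pi_lt_d2
  rw [abs_le]
  constructor <;> linarith [hθ.1, hθ.2]

theorem IsWeightFunction.intervalIntegrable_term (hW : IsWeightFunction W) (hB : 0 < B) (j : ℤ)
    (u v : ℝ) :
    IntervalIntegrable (fun θ => 1 / B * W ((θ - η + 2 * Real.pi * j) / B)) volume u v := by
  have h : Integrable fun θ : ℝ => W ((θ + (2 * Real.pi * j - η)) / B) :=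
    (hW.integrable.comp_div hB.ne').comp_add_right _
  refine (Integrable.const_mul (h.congr (ae_of_all _ fun θ => ?_)) _).intervalIntegrable
  simp only
  congr 2; ring

theorem IsWeightFunction.intervalIntegrable_periodizedWeight (hW : IsWeightFunction W) (hB : 0 < B)
    (hB1 : B ≤ 1 / 16) (h0 : 0 ≤ η) (h1 : η ≤ 2 * Real.pi) :
    IntervalIntegrable (fun θ => periodizedWeight W B (θ - η)) volume (-√B / 2) (√B / 2) := by
  have h := IntervalIntegrable.sum (Finset.Icc (-1 : ℤ) 1) fun j _ =>
    hW.intervalIntegrable_term (η := η) hB j (-√B / 2) (√B / 2)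
  refine (intervalIntegrable_congr fun θ hθ => ?_).1 h
  rw [hW.periodizedWeight_eq_sum hB hB1
    (abs_sub_le_seven hB1 h0 h1 (Set.uIoc_subset_uIcc hθ)), Finset.sum_apply]

theorem IsWeightFunction.periodizedWeight_nonneg (hW : IsWeightFunction W) (hB : 0 < B) (x : ℝ) :
    0 ≤ periodizedWeight W B x :=
  tsum_nonneg fun _ => mul_nonneg (by positivity) (hW.nonneg _)

theorem IsWeightFunction.integral_periodizedWeight_nonneg (hW : IsWeightFunction W) (hB : 0 < B) :
    0 ≤ ∫ θ in (-√B / 2)..(√B / 2), periodizedWeight W B (θ - η) :=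
  intervalIntegral.integral_nonneg (by linarith [Real.sqrt_nonneg B])
    fun _ _ => hW.periodizedWeight_nonneg hB _

/-- A frequency deep inside the band, up to a multiple of `2π`, receives at least the full
weight. -/
theorem IsWeightFunction.one_le_integral_periodizedWeight (hW : IsWeightFunction W) (hB : 0 < B)
    (hB1 : B ≤ 1 / 16) (h0 : 0 ≤ η) (h1 : η ≤ 2 * Real.pi)
    (hnear : ∃ j : ℤ, |η - 2 * Real.pi * j| ≤ √B / 4) :
    1 ≤ ∫ θ in (-√B / 2)..(√B / 2), periodizedWeight W B (θ - η) := by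
  obtain ⟨j, hj⟩ := hnear
  have hs0 : 0 < √B := Real.sqrt_pos.2 hB
  have hsB : √B * √B = B := Real.mul_self_sqrt hB.le
  have hs : √B ≤ 1 / 4 := by
    rw [Real.sqrt_le_left (by norm_num)]; norm_num; linarith
  have hpi := Real.pi_gt_three
  have hj1 : j ∈ Finset.Icc (-1 : ℤ) 1 := by
    have h2 := abs_le.1 hj
    have hlo : (-1 : ℝ) < j := by nlinarith
    have hhi : (j : ℝ) < 2 := by nlinarith
    have hlo' : (-1 : ℤ) < j := by exact_mod_cast hlo
    have hhi' : j < (2 : ℤ) := by exact_mod_cast hhi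
    exact Finset.mem_Icc.2 ⟨by omega, by omega⟩
  set d := 2 * Real.pi * j - η with hd
  have hd' := abs_le.1 hj
  have hterm : ∫ θ in (-√B / 2)..(√B / 2), 1 / B * W ((θ - η + 2 * Real.pi * j) / B) = 1 := by
    have heq : ∀ θ, 1 / B * W ((θ - η + 2 * Real.pi * j) / B) = 1 / B * W ((θ + d) / B) := by
      intro θ; congr 3; rw [hd]; ring
    simp_rw [heq]
    rw [intervalIntegral.integral_const_mul,
      intervalIntegral.integral_comp_add_right (fun x => W (x / B)) d,
      intervalIntegral.integral_comp_div _ hB.ne', smul_eq_mul, ← mul_assoc,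
      one_div_mul_cancel hB.ne', one_mul,
      intervalIntegral.integral_eq_integral_of_support_subset, hW.integral_eq_one]
    intro x hx
    have hx1 : |x| < 1 := by
      by_contra hge
      exact hx (hW.eq_zero x (not_lt.1 hge))
    have hx2 := abs_lt.1 hx1
    constructor
    · rw [div_lt_iff₀ hB]; nlinarith
    · rw [le_div_iff₀ hB]; nlinarith
  rw [← hterm]
  refine intervalIntegral.integral_mono_on (by linarith)
    (hW.intervalIntegrable_term hB j _ _)
    (hW.intervalIntegrable_periodizedWeight hB hB1 h0 h1) fun θ hθ => ?_
  rw [hW.periodizedWeight_eq_sum hB hB1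
    (abs_sub_le_seven hB1 h0 h1 (by rwa [Set.uIcc_of_le (by linarith)]))]
  exact Finset.single_le_sum
    (f := fun j : ℤ => 1 / B * W ((θ - η + 2 * Real.pi * j) / B))
    (fun i _ => mul_nonneg (by positivity) (hW.nonneg _)) hj1

end Weights

/-! ### A scalar lower bound for the Hilbert--Schmidt norm -/

section LowerBound

variable {M : Type*} [MeasurableSpace M] {ν : Measure M} {Ω : Type*}

/-- The series of spatial means of a functional series. -/
noncomputable def spatialMean (X : ℤ → Ω → Lp ℝ 2 ν) (t : ℤ) (w : Ω) : ℝ :=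
  ∫ x, X t w x ∂ν

/-- Square integrability of the kernel keeps the norm finite, so that `toReal` loses nothing. -/
theorem norm_integral_le_hilbertSchmidtNorm [IsFiniteMeasure ν] (hν : ν Set.univ ≤ 1)
    {k : M → M → ℂ} (hk : MemLp (fun z : M × M => k z.1 z.2) 2 (ν.prod ν)) :
    ‖∫ z : M × M, k z.1 z.2 ∂(ν.prod ν)‖ ≤ hilbertSchmidtNorm ν k := by
  have hint := hk.integrable (by norm_num)
  have hprod : (ν.prod ν) Set.univ ≤ 1 := by
    rw [← Set.univ_prod_univ, Measure.prod_prod]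
    exact mul_le_one' hν hν
  refine (norm_integral_le_integral_norm _).trans ?_
  rw [integral_norm_eq_lintegral_enorm hint.aestronglyMeasurable, ← eLpNorm_one_eq_lintegral_enorm]
  refine ENNReal.toReal_mono hk.eLpNorm_ne_top ?_
  refine (eLpNorm_le_eLpNorm_mul_rpow_measure_univ one_le_two hint.aestronglyMeasurable).trans ?_
  refine mul_le_of_le_one_right' (ENNReal.rpow_le_one hprod ?_)
  norm_num

variable (X : ℤ → Ω → Lp ℝ 2 ν) (T : ℕ) (w : Ω)

theorem memLp_fDFT (θ : ℝ) : MemLp (fDFT X T w θ) 2 ν := by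
  unfold fDFT
  refine MemLp.const_mul ?_ _
  refine memLp_finsetSum _ fun t _ => ?_
  exact (Lp.memLp (X t w)).ofReal.mul_const _

theorem integral_fDFT [IsFiniteMeasure ν] (θ : ℝ) : ∫ x, fDFT X T w θ x ∂ν =
    (1 / √(2 * Real.pi * T) : ℝ) * ∑ t ∈ Finset.range T,
      (spatialMean X t w : ℂ) * Complex.exp (-Complex.I * θ * t) := by
  unfold fDFT spatialMean
  have hint : ∀ t : ℕ, Integrable (fun x => (X (t : ℤ) w x : ℂ)) ν := fun t =>
    ((Lp.memLp (X t w)).integrable (by norm_num)).ofReal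
  rw [integral_const_mul, integral_finsetSum _ fun t _ => (hint t).mul_const _]
  simp_rw [integral_mul_const, integral_complex_ofReal]

theorem memLp_periodogram [IsFiniteMeasure ν] (θ : ℝ) :
    MemLp (fun z : M × M => periodogram X T w θ z.1 z.2) 2 (ν.prod ν) := by
  have h1 := memLp_fDFT X T w θ
  have h2 := memLp_fDFT X T w (-θ)
  have hint := (h1.integrable (by norm_num)).mul_prod (h2.integrable (by norm_num))
  unfold periodogram
  rw [memLp_two_iff_integrable_sq_norm hint.aestronglyMeasurable]
  simp_rw [norm_mul, mul_pow]
  exact ((memLp_two_iff_integrable_sq_norm h1.1).1 h1).mul_prod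
    ((memLp_two_iff_integrable_sq_norm h2.1).1 h2)

theorem integral_periodogram [IsFiniteMeasure ν] (θ : ℝ) :
    ∫ z : M × M, periodogram X T w θ z.1 z.2 ∂(ν.prod ν) =
      ((1 / (2 * Real.pi * T) * ‖∑ t ∈ Finset.range T,
        (spatialMean X t w : ℂ) * Complex.exp (-Complex.I * θ * t)‖ ^ 2 : ℝ) : ℂ) := by
  unfold periodogram
  rw [integral_prod_mul, integral_fDFT, integral_fDFT]
  have hconj : ∑ t ∈ Finset.range T,
      (spatialMean X t w : ℂ) * Complex.exp (-Complex.I * ((-θ : ℝ) : ℂ) * t) =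
      (starRingEnd ℂ) (∑ t ∈ Finset.range T,
        (spatialMean X t w : ℂ) * Complex.exp (-Complex.I * θ * t)) := by
    rw [map_sum]
    refine Finset.sum_congr rfl fun t _ => ?_
    rw [map_mul, ← Complex.exp_conj]
    simp
  rw [hconj, mul_mul_mul_comm, Complex.mul_conj']
  push_cast
  rw [← Complex.ofReal_ofNat, ← Complex.ofReal_natCast, ← Complex.ofReal_mul,
    ← Complex.ofReal_mul]
  congr 1
  rw [← Complex.ofReal_one, ← Complex.ofReal_div, ← Complex.ofReal_div, ← Complex.ofReal_mul,
    div_mul_div_comm, Real.mul_self_sqrt (by positivity), one_mul]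

variable {X T w} {W : ℝ → ℝ} {B : ℝ}

theorem testStatistic_eq_sum (hW : IsWeightFunction W) (hB : 0 < B) (hB1 : B ≤ 1 / 16)
    (x y : M) :
    testStatistic W B X T w x y = ∑ s ∈ Finset.Icc 1 (T - 1),
      ((√(B * T) / √B * (2 * Real.pi / T) * ∫ θ in (-√B / 2)..(√B / 2),
        periodizedWeight W B (θ - 2 * Real.pi * s / T) : ℝ) : ℂ) *
      periodogram X T w (2 * Real.pi * s / T) x y := by
  unfold testStatistic weightedPeriodogram
  have hη : ∀ s ∈ Finset.Icc 1 (T - 1), 0 ≤ 2 * Real.pi * s / T ∧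
      2 * Real.pi * s / T ≤ 2 * Real.pi := by
    intro s hs
    have hs' := Finset.mem_Icc.1 hs
    have hT : (0 : ℝ) < T := by
      have : 0 < T := by omega
      exact_mod_cast this
    refine ⟨by positivity, ?_⟩
    rw [div_le_iff₀ hT]
    have : (s : ℝ) ≤ T := by
      have : s ≤ T := by omega
      exact_mod_cast this
    have := Real.two_pi_pos
    gcongr
  have hint : ∀ s ∈ Finset.Icc 1 (T - 1), IntervalIntegrable (fun θ =>
      (periodizedWeight W B (θ - 2 * Real.pi * s / T) : ℂ)) volume (-√B / 2) (√B / 2) := by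
    intro s hs
    have := hW.intervalIntegrable_periodizedWeight hB hB1 (hη s hs).1 (hη s hs).2
    exact ⟨this.1.ofReal, this.2.ofReal⟩
  simp_rw [Finset.mul_sum, Finset.sum_div]
  rw [intervalIntegral.integral_finsetSum, Finset.mul_sum]
  · refine Finset.sum_congr rfl fun s hs => ?_
    simp_rw [mul_div_assoc, ← mul_assoc]
    rw [intervalIntegral.integral_mul_const, intervalIntegral.integral_const_mul,
      intervalIntegral.integral_ofReal]
    push_cast
    ring
  · intro s hs
    exact (((hint s hs).mul_const _).const_mul _).div_const _

/-- The Hilbert--Schmidt norm of the test statistic dominates the weighted energy of the spatial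
means: test the kernel against the constant function. -/
theorem le_hilbertSchmidtNorm_testStatistic [IsFiniteMeasure ν] (hν : ν Set.univ ≤ 1)
    (hW : IsWeightFunction W) (hB : 0 < B) (hB1 : B ≤ 1 / 16) (hT : 0 < T) :
    1 / (T * √T) * ∑ s ∈ Finset.Icc 1 (T - 1),
        (∫ θ in (-√B / 2)..(√B / 2), periodizedWeight W B (θ - 2 * Real.pi * s / T)) *
        ‖∑ t ∈ Finset.range T, (spatialMean X t w : ℂ) *
          Complex.exp (-Complex.I * (2 * Real.pi * s / T) * t)‖ ^ 2 ≤
      hilbertSchmidtNorm ν (testStatistic W B X T w) := by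
  have hT' : (0 : ℝ) < T := by exact_mod_cast hT
  have hk : MemLp (fun z : M × M => testStatistic W B X T w z.1 z.2) 2 (ν.prod ν) := by
    simp_rw [testStatistic_eq_sum hW hB hB1]
    exact memLp_finsetSum _ fun s _ => (memLp_periodogram X T w _).const_mul _
  refine le_trans (le_of_eq ?_) (norm_integral_le_hilbertSchmidtNorm hν hk)
  simp_rw [testStatistic_eq_sum hW hB hB1]
  rw [integral_finsetSum _ fun s _ =>
    ((memLp_periodogram X T w _).integrable (by norm_num)).const_mul _]
  simp_rw [integral_const_mul, integral_periodogram, ← Complex.ofReal_mul, ← Complex.ofReal_sum]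
  rw [Complex.norm_real, Real.norm_of_nonneg]
  · rw [Finset.mul_sum]
    refine Finset.sum_congr rfl fun s _ => ?_
    have hBT : √(B * T) = √B * √T := Real.sqrt_mul hB.le _
    have hsB : √B ≠ 0 := (Real.sqrt_pos.2 hB).ne'
    have hsT : √(T : ℝ) ≠ 0 := (Real.sqrt_pos.2 hT').ne'
    have hsT2 : √(T : ℝ) ^ 2 = T := Real.sq_sqrt hT'.le
    have hpi := Real.pi_pos.ne'
    push_cast
    rw [hBT]
    field_simp
    rw [hsT2]
  · refine Finset.sum_nonneg fun s _ => mul_nonneg (mul_nonneg (by positivity)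
      (hW.integral_periodizedWeight_nonneg hB)) (by positivity)

end LowerBound

/-! ### Moments of the spatial means -/

section Tensor

variable {M : Type*} [MeasurableSpace M] {ν : Measure M} [IsFiniteMeasure ν]

theorem coe_tensor4 (f : Fin 4 → Lp ℝ 2 ν) : tensor4 (f 0) (f 1) (f 2) (f 3)
    =ᵐ[Measure.pi fun _ => ν] fun x => ∏ i, f i (x i) := by
  have h : ![f 0, f 1, f 2, f 3] = f := by ext i : 1; fin_cases i <;> rfl
  refine (MemLp.coeFn_toLp (memLp_tensor4 ![f 0, f 1, f 2, f 3])).trans (ae_of_all _ fun x => ?_)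
  simp only
  rw [h]

theorem coeFn_eval {f g : M → ℝ} (h : f =ᵐ[ν] g) (i : Fin 4) :
    (fun x : Fin 4 → M => f (x i)) =ᵐ[Measure.pi fun _ => ν] fun x => g (x i) :=
  (Measure.quasiMeasurePreserving_eval (fun _ : Fin 4 => ν) i).ae_eq_comp h

/-- The fourfold tensor product as a multilinear map. -/
noncomputable def tensor4Multilinear :
    MultilinearMap ℝ (fun _ : Fin 4 => Lp ℝ 2 ν) (Lp ℝ 2 (Measure.pi fun _ : Fin 4 => ν)) where
  toFun f := tensor4 (f 0) (f 1) (f 2) (f 3)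
  map_update_add' := by
    intro hdec f i g g'
    obtain rfl : hdec = instDecidableEqFin 4 := Subsingleton.elim _ _
    refine Lp.ext ?_
    filter_upwards [coe_tensor4 (Function.update f i (g + g')), coe_tensor4 (Function.update f i g),
      coe_tensor4 (Function.update f i g'),
      Lp.coeFn_add (tensor4 (Function.update f i g 0) (Function.update f i g 1)
        (Function.update f i g 2) (Function.update f i g 3))
        (tensor4 (Function.update f i g' 0) (Function.update f i g' 1)
        (Function.update f i g' 2) (Function.update f i g' 3)),
      coeFn_eval (Lp.coeFn_add g g') i] with x h1 h2 h3 h4 h5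
    rw [h1, h4, Pi.add_apply, h2, h3]
    rw [← Finset.mul_prod_erase _ _ (Finset.mem_univ i),
      ← Finset.mul_prod_erase _ (fun j => (Function.update f i g j) (x j)) (Finset.mem_univ i),
      ← Finset.mul_prod_erase _ (fun j => (Function.update f i g' j) (x j)) (Finset.mem_univ i)]
    simp only [Function.update_self]
    have he : ∀ u : Lp ℝ 2 ν, ∏ j ∈ Finset.univ.erase i, (Function.update f i u j) (x j) =
        ∏ j ∈ Finset.univ.erase i, (f j) (x j) := fun u =>
      Finset.prod_congr rfl fun j hj => by rw [Function.update_of_ne (Finset.ne_of_mem_erase hj)]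
    rw [he, he, he, h5, Pi.add_apply, add_mul]
  map_update_smul' := by
    intro hdec f i c g
    obtain rfl : hdec = instDecidableEqFin 4 := Subsingleton.elim _ _
    refine Lp.ext ?_
    filter_upwards [coe_tensor4 (Function.update f i (c • g)), coe_tensor4 (Function.update f i g),
      Lp.coeFn_smul c (tensor4 (Function.update f i g 0) (Function.update f i g 1)
        (Function.update f i g 2) (Function.update f i g 3)),
      coeFn_eval (Lp.coeFn_smul c g) i] with x h1 h2 h3 h4
    rw [h1, h3, Pi.smul_apply, h2]
    rw [← Finset.mul_prod_erase _ _ (Finset.mem_univ i),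
      ← Finset.mul_prod_erase _ (fun j => (Function.update f i g j) (x j)) (Finset.mem_univ i)]
    simp only [Function.update_self]
    have he : ∀ u : Lp ℝ 2 ν, ∏ j ∈ Finset.univ.erase i, (Function.update f i u j) (x j) =
        ∏ j ∈ Finset.univ.erase i, (f j) (x j) := fun u =>
      Finset.prod_congr rfl fun j hj => by rw [Function.update_of_ne (Finset.ne_of_mem_erase hj)]
    rw [he, he, h4, Pi.smul_apply, smul_eq_mul, smul_eq_mul, mul_assoc]

theorem tensor4Multilinear_apply (f : Fin 4 → Lp ℝ 2 ν) :
    tensor4Multilinear f = tensor4 (f 0) (f 1) (f 2) (f 3) := rfl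

theorem norm_sq_eq_integral_sq {N : Type*} [MeasurableSpace N] {μ : Measure N} (f : Lp ℝ 2 μ) :
    ‖f‖ ^ 2 = ∫ x, f x ^ 2 ∂μ := by
  rw [← real_inner_self_eq_norm_sq, L2.inner_def]
  simp [sq]

theorem norm_tensor4 (f : Fin 4 → Lp ℝ 2 ν) :
    ‖tensor4 (f 0) (f 1) (f 2) (f 3)‖ = ∏ i, ‖f i‖ := by
  refine (pow_left_inj₀ (norm_nonneg _) (Finset.prod_nonneg fun _ _ => norm_nonneg _)
    two_ne_zero).1 ?_
  rw [norm_sq_eq_integral_sq, ← Finset.prod_pow]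
  simp_rw [norm_sq_eq_integral_sq]
  rw [← integral_fintype_prod_eq_prod (fun i x => f i x ^ 2)]
  refine integral_congr_ae ?_
  filter_upwards [coe_tensor4 f] with x hx
  rw [hx, Finset.prod_pow]

theorem continuous_tensor4 : Continuous fun q : Lp ℝ 2 ν × Lp ℝ 2 ν × Lp ℝ 2 ν × Lp ℝ 2 ν =>
    tensor4 q.1 q.2.1 q.2.2.1 q.2.2.2 := by
  have h := (tensor4Multilinear (ν := ν)).continuous_of_bound 1 fun f => by
    rw [one_mul, tensor4Multilinear_apply]; exact (norm_tensor4 f).le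
  have h2 : Continuous fun q : Lp ℝ 2 ν × Lp ℝ 2 ν × Lp ℝ 2 ν × Lp ℝ 2 ν =>
      (![q.1, q.2.1, q.2.2.1, q.2.2.2] : Fin 4 → Lp ℝ 2 ν) := by
    refine continuous_pi fun i => ?_
    fin_cases i <;> simp only [Fin.zero_eta, Fin.mk_one, Fin.reduceFinMk, Matrix.cons_val] <;>
      fun_prop
  refine (h.comp h2).congr fun q => ?_
  rw [Function.comp_apply, tensor4Multilinear_apply]
  simp only [Matrix.cons_val]

theorem integrable_tensor4 {Ω : Type*} [MeasurableSpace Ω] {P : Measure Ω} [IsFiniteMeasure P]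
    {f g h k : Ω → Lp ℝ 2 ν} (hf : MemLp f 4 P) (hg : MemLp g 4 P) (hh : MemLp h 4 P)
    (hk : MemLp k 4 P) : Integrable (fun w => tensor4 (f w) (g w) (h w) (k w)) P := by
  have hm : AEStronglyMeasurable (fun w => tensor4 (f w) (g w) (h w) (k w)) P :=
    have hq := hf.1.prodMk (hg.1.prodMk (hh.1.prodMk hk.1))
    have key : ∀ F : Lp ℝ 2 ν × Lp ℝ 2 ν × Lp ℝ 2 ν × Lp ℝ 2 ν →
        Lp ℝ 2 (Measure.pi fun _ : Fin 4 => ν), Continuous F →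
        AEStronglyMeasurable (fun w => F (f w, g w, h w, k w)) P :=
      fun F hF => hF.comp_aestronglyMeasurable hq
    key _ continuous_tensor4
  refine (integrable_mul_four hf.norm hg.norm hh.norm hk.norm).mono' hm (ae_of_all _ fun w => ?_)
  have := norm_tensor4 ![f w, g w, h w, k w]
  simp only [Matrix.cons_val] at this
  rw [this]
  simp [Fin.prod_univ_four, mul_assoc]

/-- Integration against a finite measure, as a continuous linear functional on `L²`. -/
noncomputable def integralL2 {N : Type*} [MeasurableSpace N] (μ : Measure N) [IsFiniteMeasure μ] :
    Lp ℝ 2 μ →L[ℝ] ℝ :=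
  innerSL ℝ (indicatorConstLp 2 MeasurableSet.univ (measure_ne_top μ Set.univ) (1 : ℝ))

theorem integralL2_apply {N : Type*} [MeasurableSpace N] (μ : Measure N) [IsFiniteMeasure μ]
    (f : Lp ℝ 2 μ) : integralL2 μ f = ∫ x, f x ∂μ := by
  rw [integralL2, innerSL_apply_apply, L2.inner_indicatorConstLp_one, Measure.restrict_univ]

theorem integral_tensor4 (f g h k : Lp ℝ 2 ν) :
    integralL2 (Measure.pi fun _ => ν) (tensor4 f g h k) =
      (∫ x, f x ∂ν) * (∫ x, g x ∂ν) * ((∫ x, h x ∂ν) * (∫ x, k x ∂ν)) := by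
  rw [integralL2_apply]
  have h1 := integral_fintype_prod_eq_prod (fun i x => (![f, g, h, k] i : Lp ℝ 2 ν) x)
    (μ := fun _ => ν)
  have h2 := integral_congr_ae (coe_tensor4 ![f, g, h, k])
  simp only [Matrix.cons_val] at h2
  rw [h2, h1]
  simp [Fin.prod_univ_four, mul_assoc]

end Tensor

section Moments

variable {M : Type*} [MeasurableSpace M] {ν : Measure M} [IsFiniteMeasure ν]
  {Ω : Type*} [MeasurableSpace Ω] {P : Measure Ω}
  {X : ℤ → Ω → Lp ℝ 2 ν}

theorem memLp_spatialMean (hX : ∀ t, MemLp (X t) 4 P) (t : ℤ) : MemLp (spatialMean X t) 4 P := by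
  refine ((integralL2 ν).comp_memLp' (hX t)).ae_eq (ae_of_all _ fun w => ?_)
  simp [integralL2_apply, spatialMean]

theorem integral_integral_tensor4 [IsProbabilityMeasure P] {f₁ f₂ f₃ f₄ : Ω × Ω → Lp ℝ 2 ν}
    (h₁ : MemLp f₁ 4 (P.prod P))
    (h₂ : MemLp f₂ 4 (P.prod P)) (h₃ : MemLp f₃ 4 (P.prod P)) (h₄ : MemLp f₄ 4 (P.prod P)) :
    integralL2 (Measure.pi fun _ => ν)
        (∫ w, ∫ w', tensor4 (f₁ (w, w')) (f₂ (w, w')) (f₃ (w, w')) (f₄ (w, w')) ∂P ∂P) =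
      ∫ z, (∫ x, f₁ z x ∂ν) * (∫ x, f₂ z x ∂ν) * ((∫ x, f₃ z x ∂ν) * (∫ x, f₄ z x ∂ν))
        ∂(P.prod P) := by
  have hint := integrable_tensor4 h₁ h₂ h₃ h₄
  rw [← integral_prod (fun z => tensor4 (f₁ z) (f₂ z) (f₃ z) (f₄ z)) hint,
    ← ContinuousLinearMap.integral_comp_comm _ hint]
  simp_rw [integral_tensor4]

/-- The fourth moments of the spatial means, by pairings and the cumulant. -/
theorem integral_spatialMean_four [IsProbabilityMeasure P] (hX : ∀ t, MemLp (X t) 4 P)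
    (a b c e : ℤ) :
    ∫ w, spatialMean X a w * spatialMean X b w * (spatialMean X c w * spatialMean X e w) ∂P =
      (∫ w, spatialMean X a w * spatialMean X b w ∂P) *
          (∫ w, spatialMean X c w * spatialMean X e w ∂P) +
        (∫ w, spatialMean X a w * spatialMean X c w ∂P) *
          (∫ w, spatialMean X b w * spatialMean X e w ∂P) +
        (∫ w, spatialMean X a w * spatialMean X e w ∂P) *
          (∫ w, spatialMean X b w * spatialMean X c w ∂P) +
        integralL2 (Measure.pi fun _ => ν) (cum4 P X a b c e) := by
  have hfst : ∀ t, MemLp (fun z : Ω × Ω => X t z.1) 4 (P.prod P) := fun t =>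
    (hX t).comp_measurePreserving measurePreserving_fst
  have hsnd : ∀ t, MemLp (fun z : Ω × Ω => X t z.2) 4 (P.prod P) := fun t =>
    (hX t).comp_measurePreserving measurePreserving_snd
  have h0 : integralL2 (Measure.pi fun _ => ν)
      (∫ w, tensor4 (X a w) (X b w) (X c w) (X e w) ∂P) =
      ∫ w, spatialMean X a w * spatialMean X b w *
        (spatialMean X c w * spatialMean X e w) ∂P := by
    rw [← ContinuousLinearMap.integral_comp_comm _ (integrable_tensor4 (hX a) (hX b) (hX c) (hX e))]
    simp_rw [integral_tensor4]
    rfl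
  have hprod := fun s t u v => integral_prod_mul (μ := P) (ν := P)
    (fun w => spatialMean X s w * spatialMean X t w)
    (fun w => spatialMean X u w * spatialMean X v w)
  have h1 := integral_integral_tensor4 (hfst a) (hfst b) (hsnd c) (hsnd e)
  have h2 := integral_integral_tensor4 (hfst a) (hsnd b) (hfst c) (hsnd e)
  have h3 := integral_integral_tensor4 (hfst a) (hsnd b) (hsnd c) (hfst e)
  rw [cum4, map_sub, map_sub, map_sub, h0, h1, h2, h3, ← hprod, ← hprod, ← hprod]
  have e2 : ∀ z : Ω × Ω, (∫ x, X a z.1 x ∂ν) * (∫ x, X b z.2 x ∂ν) *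
      ((∫ x, X c z.1 x ∂ν) * (∫ x, X e z.2 x ∂ν)) = spatialMean X a z.1 * spatialMean X c z.1 *
        (spatialMean X b z.2 * spatialMean X e z.2) := fun z => by
    unfold spatialMean; ring
  have e3 : ∀ z : Ω × Ω, (∫ x, X a z.1 x ∂ν) * (∫ x, X b z.2 x ∂ν) *
      ((∫ x, X c z.2 x ∂ν) * (∫ x, X e z.1 x ∂ν)) = spatialMean X a z.1 * spatialMean X e z.1 *
        (spatialMean X b z.2 * spatialMean X c z.2) := fun z => by
    unfold spatialMean; ring
  simp_rw [e2, e3]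
  unfold spatialMean
  ring

end Moments

section Covariance

variable {M : Type*} [MeasurableSpace M] {ν : Measure M} [IsFiniteMeasure ν]
  {Ω : Type*} [MeasurableSpace Ω] {P : Measure Ω}
  {X : ℤ → Ω → Lp ℝ 2 ν}

variable (ν) in
/-- The constant function `1` in `L²(M; ℂ)`. -/
noncomputable def oneL2 : Lp ℂ 2 ν :=
  indicatorConstLp 2 MeasurableSet.univ (measure_ne_top ν Set.univ) (1 : ℂ)

theorem inner_oneL2_toComplexL2 (u : Lp ℝ 2 ν) :
    inner ℂ (oneL2 ν) (toComplexL2 u) = ((∫ x, u x ∂ν : ℝ) : ℂ) := by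
  rw [oneL2, L2.inner_indicatorConstLp_one, Measure.restrict_univ, ← integral_complex_ofReal]
  exact integral_congr_ae (ContinuousLinearMap.coeFn_compLp _ u)

theorem inner_toComplexL2_oneL2 (u : Lp ℝ 2 ν) :
    inner ℂ (toComplexL2 u) (oneL2 ν) = ((∫ x, u x ∂ν : ℝ) : ℂ) := by
  rw [← inner_conj_symm, inner_oneL2_toComplexL2, Complex.conj_ofReal]

theorem inner_crossCov_oneL2 [IsFiniteMeasure P] (hX : ∀ t, MemLp (X t) 4 P) (s t : ℤ) :
    inner ℂ (oneL2 ν) (crossCov P X s t (oneL2 ν)) =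
      ((∫ w, spatialMean X s w * spatialMean X t w ∂P : ℝ) : ℂ) := by
  have hs : MemLp (fun w => (spatialMean X s w : ℂ)) 2 P :=
    ((memLp_spatialMean hX s).mono_exponent (by norm_num)).ofReal
  have ht : MemLp (fun w => toComplexL2 (X t w)) 2 P :=
    (Complex.ofRealCLM.compLpL 2 ν).comp_memLp' ((hX t).mono_exponent (by norm_num))
  have hint : Integrable (fun w => (spatialMean X s w : ℂ) • toComplexL2 (X t w)) P :=
    memLp_one_iff_integrable.1 (ht.smul hs)
  unfold crossCov
  simp_rw [inner_toComplexL2_oneL2]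
  rw [← integral_complex_ofReal]
  refine (integral_inner hint _).symm.trans ?_
  refine integral_congr_ae (ae_of_all _ fun w => ?_)
  simp only
  rw [inner_smul_right, inner_oneL2_toComplexL2, Complex.ofReal_mul]
  rfl

end Covariance

/-! ### Diagonal operators -/

section Diagonal

variable {H : Type*} [NormedAddCommGroup H] [InnerProductSpace ℂ H]

theorem HilbertBasis.hasSum_inner_diagonal {ι : Type*} (S : HilbertBasis ι ℂ H) {F : H →L[ℂ] H}
    {f : ι → ℝ} (hF : ∀ i, F (S i) = (f i : ℂ) • S i) (v : H) :
    HasSum (fun i => ((f i * ‖inner ℂ (S i) v‖ ^ 2 : ℝ) : ℂ)) (inner ℂ v (F v)) := by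
  have h := ((S.hasSum_repr v).mapL F).mapL (innerSL ℂ v)
  have e : (fun i => ((f i * ‖inner ℂ (S i) v‖ ^ 2 : ℝ) : ℂ)) =
      fun i => innerSL ℂ v (F (S.repr v i • S i)) := by
    ext i
    rw [map_smul, hF, innerSL_apply_apply, inner_smul_right, inner_smul_right, S.repr_apply_apply,
      ← inner_conj_symm v (S i), mul_left_comm, Complex.mul_conj']
    push_cast
    rfl
  rw [e]
  exact h

theorem HilbertBasis.inner_diagonal_eq_ofReal {ι : Type*} (S : HilbertBasis ι ℂ H) {F : H →L[ℂ] H}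
    {f : ι → ℝ} (hF : ∀ i, F (S i) = (f i : ℂ) • S i) (v : H) :
    inner ℂ v (F v) = ((inner ℂ v (F v)).re : ℂ) ∧
    HasSum (fun i => f i * ‖inner ℂ (S i) v‖ ^ 2) (inner ℂ v (F v)).re := by
  have h := S.hasSum_inner_diagonal hF v
  refine ⟨?_, ?_⟩
  · have h2 := Complex.hasSum_im h
    simp only [Complex.ofReal_im] at h2
    apply Complex.ext
    · simp
    · simpa using h2.unique hasSum_zero
  · simpa only [Complex.ofReal_re] using Complex.hasSum_re h

theorem HilbertBasis.hasSum_norm_sq_inner {ι : Type*} (S : HilbertBasis ι ℂ H) (v : H) :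
    HasSum (fun i => ‖inner ℂ (S i) v‖ ^ 2) (‖v‖ ^ 2) := by
  have h := (S.inner_diagonal_eq_ofReal (F := ContinuousLinearMap.id ℂ H) (f := fun _ => 1)
    (by simp) v).2
  simpa [← inner_self_eq_norm_sq (𝕜 := ℂ)] using h

theorem exp_smul_apply_eigenvector [CompleteSpace H] {A : H →L[ℂ] H} {a z : ℂ} {v : H}
    (hv : A v = a • v) : NormedSpace.exp (z • A) v = Complex.exp (z * a) • v := by
  have hpow : ∀ n : ℕ, ((z • A) ^ n) v = (z * a) ^ n • v := by
    intro n
    induction n with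
    | zero => simp
    | succ n ih =>
      rw [pow_succ', mul_apply_eq_comp, ih, map_smul, smul_apply,
        hv, smul_smul, smul_smul, pow_succ, mul_assoc]
  have h1 : HasSum (fun n : ℕ => ((n.factorial : ℂ)⁻¹ • (z • A) ^ n) v)
      (NormedSpace.exp (z • A) v) :=
    (NormedSpace.exp_series_hasSum_exp' (𝕂 := ℂ) (z • A)).mapL (ContinuousLinearMap.apply ℂ H v)
  have h2 : HasSum (fun n : ℕ => ((n.factorial : ℂ)⁻¹ • (z * a) ^ n) • v)
      (Complex.exp (z * a) • v) := by
    rw [Complex.exp_eq_exp_ℂ]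
    exact (NormedSpace.exp_series_hasSum_exp' (𝕂 := ℂ) (z * a)).smul_const v
  refine h1.unique ?_
  convert h2 using 1
  ext n
  rw [smul_apply, hpow, smul_assoc]

theorem absRpowNeg_apply_eigenvector [CompleteSpace H] {A : H →L[ℂ] H} {a : ℝ} (θ : ℝ)
    {v : H} (hv : A v = (a : ℂ) • v) :
    absRpowNeg θ A v = ((Real.exp (-Real.log |θ| * a) : ℝ) : ℂ) • v := by
  rw [absRpowNeg, exp_smul_apply_eigenvector hv, Complex.ofReal_exp]
  push_cast
  rfl

theorem norm_inner_le_traceNorm (A : H →L[ℂ] H) {v : H} (hv : ‖v‖ = 1) :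
    ‖inner ℂ v (A v)‖ₑ ≤ traceNorm A := by
  have ho : Orthonormal ℂ (fun _ : Fin 1 => v) := by
    refine ⟨fun _ => hv, fun i j hij => (hij (Subsingleton.elim i j)).elim⟩
  unfold traceNorm
  refine le_iSup_of_le 1 (le_iSup_of_le (fun _ => v) (le_iSup_of_le (fun _ => v)
    (le_iSup_of_le ho (le_iSup_of_le ho ?_))))
  simp

end Diagonal

/-! ### Square summability of the covariances -/

theorem summable_sq_of_spectral_memLp {γ : ℤ → ℝ} {f : ℝ → ℂ}
    (hf : MemLp f 2 (volume.restrict (Set.Ioc (-Real.pi) Real.pi)))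
    (hγ : ∀ τ : ℤ, (γ τ : ℂ) =
      ∫ θ in (-Real.pi)..Real.pi, Complex.exp (Complex.I * θ * τ) * f θ) :
    Summable fun τ => γ τ ^ 2 := by
  have hpi := Real.pi_pos
  have hab : -Real.pi < Real.pi := by linarith
  have h := (hasSum_sq_fourierCoeffOn hab hf).summable
  have h2 : ∀ τ : ℤ, γ τ ^ 2 = (2 * Real.pi) ^ 2 * ‖fourierCoeffOn hab f (-τ)‖ ^ 2 := by
    intro τ
    have hc : (γ τ : ℂ) = (2 * Real.pi : ℝ) * fourierCoeffOn hab f (-τ) := by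
      rw [fourierCoeffOn_eq_integral, neg_neg, hγ]
      have he : ∀ θ : ℝ, fourier τ (θ : AddCircle (Real.pi - -Real.pi)) • f θ =
          Complex.exp (Complex.I * θ * τ) * f θ := by
        intro θ
        rw [fourier_coe_apply, smul_eq_mul]
        congr 2
        push_cast
        have : (Real.pi : ℂ) ≠ 0 := by exact_mod_cast hpi.ne'
        field_simp
        ring
      simp_rw [he]
      rw [Complex.real_smul, ← mul_assoc, ← Complex.ofReal_mul]
      have : 2 * Real.pi * (1 / (Real.pi - -Real.pi)) = 1 := by field_simp; ring
      rw [this]; simp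
    have hn := congrArg norm hc
    rw [Complex.norm_real, norm_mul, Complex.norm_real, Real.norm_eq_abs, Real.norm_eq_abs,
      abs_of_pos (by positivity : (0 : ℝ) < 2 * Real.pi)] at hn
    rw [← sq_abs, hn, mul_pow]
  simp_rw [h2]
  exact ((Equiv.neg ℤ).summable_iff.2 h).mul_left _

/-! ### The spectral density of the spatial means -/

section Spectral

variable {d : ℕ} {M : Type*} [MetricSpace M] [MeasurableSpace M] [BorelSpace M]

theorem riemannianProb_univ_le_one : riemannianProb d M Set.univ ≤ 1 := by
  rw [riemannianProb, Measure.smul_apply, smul_eq_mul]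
  exact ENNReal.inv_mul_le_one _

variable [ChartedSpace (EuclideanSpace ℝ (Fin d)) M]
  [RiemannianBundle (fun x : M => TangentSpace (𝓡 d) x)]
  {Ω : Type*} [MeasurableSpace Ω] {P : Measure Ω} {X : ℤ → Ω → Lp ℝ 2 (riemannianProb d M)}
  {b : LaplaceBeltramiBasis d M}
  {A : Lp ℂ 2 (riemannianProb d M) →L[ℂ] Lp ℂ 2 (riemannianProb d M)} {α : ℕ → ℝ}
  {𝓜 : ℝ → Lp ℂ 2 (riemannianProb d M) →L[ℂ] Lp ℂ 2 (riemannianProb d M)} {m : ℕ → ℝ → ℝ}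
  {l L : ℝ}

/-- The measure is not zero, since there are eigenfunctions; thus the constant function has a
nonzero coefficient in the basis. -/
theorem LaplaceBeltramiBasis.exists_inner_oneL2_ne_zero (b : LaplaceBeltramiBasis d M) :
    ∃ i, inner ℂ (b.S i) (oneL2 (riemannianProb d M)) ≠ 0 := by
  by_contra! h
  have h1 := b.S.hasSum_norm_sq_inner (oneL2 (riemannianProb d M))
  simp only [h, norm_zero, ne_eq, OfNat.ofNat_ne_zero, not_false_eq_true, zero_pow] at h1
  have h2 : ‖oneL2 (riemannianProb d M)‖ = 0 := by
    simpa using (hasSum_zero.unique h1).symm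
  rw [oneL2, norm_indicatorConstLp two_ne_zero ENNReal.ofNat_ne_top] at h2
  have h3 : riemannianProb d M Set.univ = 0 := by
    simp only [norm_one, one_mul] at h2
    rw [Real.rpow_eq_zero (by positivity) (by norm_num), measureReal_eq_zero_iff] at h2
    exact h2
  rw [Measure.measure_univ_eq_zero] at h3
  have h4 : b.S ⟨0, ⟨0, b.mult_pos 0⟩⟩ = 0 := Lp.ext (by
    rw [Filter.EventuallyEq, ae_eq_bot.2 h3]; exact Filter.eventually_bot)
  have h5 := b.S.orthonormal.1 ⟨0, ⟨0, b.mult_pos 0⟩⟩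
  rw [h4, norm_zero] at h5
  exact zero_ne_one h5

theorem IsLRD.apply_basis (h : IsLRD P X b A α 𝓜 m l L) {θ : ℝ}
    (hθ : θ ∈ Set.Icc (-Real.pi) Real.pi) (i : Σ n, Fin (b.mult n)) :
    (𝓜 θ ∘L absRpowNeg θ A) (b.S i) =
      ((m i.1 θ * Real.exp (-Real.log |θ| * α i.1) : ℝ) : ℂ) • b.S i := by
  obtain ⟨n, j⟩ := i
  rw [ContinuousLinearMap.comp_apply, absRpowNeg_apply_eigenvector θ (h.A_diagonal n j), map_smul,
    h.𝓜_diagonal θ hθ n j, smul_smul, mul_comm]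
  push_cast
  rfl

/-- The spectral density of the series of spatial means. -/
noncomputable def spatialMeanSpectrum
    (A : Lp ℂ 2 (riemannianProb d M) →L[ℂ] Lp ℂ 2 (riemannianProb d M))
    (𝓜 : ℝ → Lp ℂ 2 (riemannianProb d M) →L[ℂ] Lp ℂ 2 (riemannianProb d M)) (θ : ℝ) : ℝ :=
  (inner ℂ (oneL2 (riemannianProb d M))
    ((𝓜 θ ∘L absRpowNeg θ A) (oneL2 (riemannianProb d M)))).re

theorem IsLRD.hasSum_spectrum (h : IsLRD P X b A α 𝓜 m l L) {θ : ℝ}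
    (hθ : θ ∈ Set.Icc (-Real.pi) Real.pi) :
    HasSum (fun i : Σ n, Fin (b.mult n) => m i.1 θ * Real.exp (-Real.log |θ| * α i.1) *
      ‖inner ℂ (b.S i) (oneL2 (riemannianProb d M))‖ ^ 2) (spatialMeanSpectrum A 𝓜 θ) :=
  (b.S.inner_diagonal_eq_ofReal (h.apply_basis hθ) _).2

theorem IsLRD.ofReal_spectrum (h : IsLRD P X b A α 𝓜 m l L) {θ : ℝ}
    (hθ : θ ∈ Set.Icc (-Real.pi) Real.pi) :
    inner ℂ (oneL2 (riemannianProb d M))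
      ((𝓜 θ ∘L absRpowNeg θ A) (oneL2 (riemannianProb d M))) =
      (spatialMeanSpectrum A 𝓜 θ : ℂ) :=
  (b.S.inner_diagonal_eq_ofReal (h.apply_basis hθ) _).1

theorem IsLRD.spectrum_term_nonneg (h : IsLRD P X b A α 𝓜 m l L) {θ : ℝ}
    (hθ : θ ∈ Set.Icc (-Real.pi) Real.pi) (i : Σ n, Fin (b.mult n)) :
    0 ≤ m i.1 θ * Real.exp (-Real.log |θ| * α i.1) *
      ‖inner ℂ (b.S i) (oneL2 (riemannianProb d M))‖ ^ 2 := by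
  have := (h.m_pos i.1 θ hθ).le
  positivity

theorem IsLRD.spectrum_nonneg (h : IsLRD P X b A α 𝓜 m l L) {θ : ℝ}
    (hθ : θ ∈ Set.Icc (-Real.pi) Real.pi) : 0 ≤ spatialMeanSpectrum A 𝓜 θ :=
  (h.hasSum_spectrum hθ).nonneg (h.spectrum_term_nonneg hθ)

/-- The spectral density of the spatial means has a pole of order at least `l` at zero. -/
theorem IsLRD.exists_le_spectrum (h : IsLRD P X b A α 𝓜 m l L) :
    ∃ c > 0, ∀ θ ∈ Set.Ioc (0 : ℝ) 1, c * θ ^ (-l) ≤ spatialMeanSpectrum A 𝓜 θ := by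
  obtain ⟨i, hi⟩ := b.exists_inner_oneL2_ne_zero
  have hpi := Real.pi_gt_three
  obtain ⟨θ₀, hθ₀, hmin⟩ := isCompact_Icc.exists_isMinOn (Set.nonempty_Icc.2 (by linarith))
    (h.m_continuous i.1)
  have hm0 := h.m_pos i.1 θ₀ hθ₀
  have hn : 0 < ‖inner ℂ (b.S i) (oneL2 (riemannianProb d M))‖ := norm_pos_iff.2 hi
  refine ⟨m i.1 θ₀ * ‖inner ℂ (b.S i) (oneL2 (riemannianProb d M))‖ ^ 2, by positivity,
    fun θ hθ => ?_⟩
  have hθ' : θ ∈ Set.Icc (-Real.pi) Real.pi := ⟨by linarith [hθ.1], by linarith [hθ.2]⟩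
  have hmθ : m i.1 θ₀ ≤ m i.1 θ := hmin hθ'
  refine le_trans ?_ (le_hasSum (h.hasSum_spectrum hθ') i
    fun j _ => h.spectrum_term_nonneg hθ' j)
  have hexp : θ ^ (-l) ≤ Real.exp (-Real.log |θ| * α i.1) := by
    rw [abs_of_pos hθ.1, Real.rpow_def_of_pos hθ.1]
    refine Real.exp_le_exp.2 ?_
    have h1 := Real.log_nonpos hθ.1.le hθ.2
    have h2 := (h.α_mem i.1).1
    nlinarith
  have hm1 := (h.m_pos i.1 θ hθ').le
  have h0 : 0 ≤ θ ^ (-l) := Real.rpow_nonneg hθ.1.le _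
  calc m i.1 θ₀ * ‖inner ℂ (b.S i) (oneL2 (riemannianProb d M))‖ ^ 2 * θ ^ (-l)
      = m i.1 θ₀ * θ ^ (-l) * ‖inner ℂ (b.S i) (oneL2 (riemannianProb d M))‖ ^ 2 := by ring
    _ ≤ _ := by gcongr

/-- The spectral density of the spatial means is dominated by the trace norms. -/
theorem IsLRD.enorm_spectrum_sq_le (h : IsLRD P X b A α 𝓜 m l L) {θ : ℝ}
    (hθ : θ ∈ Set.Icc (-Real.pi) Real.pi) (hθ0 : θ ≠ 0) :
    ‖(spatialMeanSpectrum A 𝓜 θ : ℂ)‖ₑ ^ 2 ≤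
      ENNReal.ofReal ((Real.pi * (‖oneL2 (riemannianProb d M)‖ ^ 2 + 1)) ^ 2) *
        (traceNorm (𝓜 θ) ^ 2 * ENNReal.ofReal (|θ| ^ (-2 * L))) := by
  set D := ‖oneL2 (riemannianProb d M)‖ ^ 2 + 1 with hD
  have hDpos : 0 < D := by positivity
  have hpi := Real.pi_gt_three
  have habs : 0 < |θ| := abs_pos.2 hθ0
  have hpow : 0 < |θ| ^ (-2 * L) := Real.rpow_pos_of_pos habs _
  by_cases htop : traceNorm (𝓜 θ) = ⊤
  · rw [htop, ENNReal.top_pow two_ne_zero, ENNReal.top_mul (by simpa using hpow),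
      ENNReal.mul_top (by simp; positivity)]
    exact le_top
  set t := (traceNorm (𝓜 θ)).toReal with ht
  have htr : traceNorm (𝓜 θ) = ENNReal.ofReal t := (ENNReal.ofReal_toReal htop).symm
  have ht0 : 0 ≤ t := ENNReal.toReal_nonneg
  have hmt : ∀ n, m n θ ≤ t := fun n => by
    have h1 := norm_inner_le_traceNorm (𝓜 θ) (b.S.orthonormal.1 ⟨n, ⟨0, b.mult_pos n⟩⟩)
    rw [h.𝓜_diagonal θ hθ n ⟨0, b.mult_pos n⟩, inner_smul_right, inner_self_eq_norm_sq_to_K,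
      b.S.orthonormal.1] at h1
    simp only [RCLike.ofReal_one, one_pow, mul_one] at h1
    rw [← ofReal_norm, Complex.norm_real, Real.norm_of_nonneg (h.m_pos n θ hθ).le, htr,
      ENNReal.ofReal_le_ofReal_iff ht0] at h1
    exact h1
  have hexp : ∀ n, Real.exp (-Real.log |θ| * α n) ≤ Real.pi * |θ| ^ (-L) := fun n => by
    rw [Real.rpow_def_of_pos habs]
    have hle : |θ| ≤ Real.pi := abs_le.2 hθ
    have hlog : Real.log |θ| ≤ Real.log Real.pi := Real.log_le_log habs hle
    have hlogpi : 0 ≤ Real.log Real.pi := Real.log_nonneg (by linarith)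
    have h1 := h.α_mem n
    have h2 := h.L_lt
    have h3 := h.l_pos
    nth_rw 1 [← Real.exp_log Real.pi_pos]
    rw [← Real.exp_add]
    refine Real.exp_le_exp.2 ?_
    have h4 : (L - α n) * Real.log |θ| ≤ (L - α n) * Real.log Real.pi :=
      mul_le_mul_of_nonneg_left hlog (by linarith [h1.2])
    have h5 : (L - α n) * Real.log Real.pi ≤ 1 * Real.log Real.pi :=
      mul_le_mul_of_nonneg_right (by linarith [h1.1]) hlogpi
    linarith
  have hup : spatialMeanSpectrum A 𝓜 θ ≤ t * (Real.pi * |θ| ^ (-L)) * D := by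
    have hsum := (b.S.hasSum_norm_sq_inner (oneL2 (riemannianProb d M))).mul_left
      (t * (Real.pi * |θ| ^ (-L)))
    have hrp : 0 ≤ |θ| ^ (-L) := (Real.rpow_pos_of_pos habs _).le
    refine (hasSum_le (fun i => ?_) (h.hasSum_spectrum hθ) hsum).trans ?_
    · refine mul_le_mul_of_nonneg_right ?_ (by positivity)
      exact mul_le_mul (hmt i.1) (hexp i.1) (Real.exp_pos _).le ht0
    · refine mul_le_mul_of_nonneg_left ?_ (by positivity)
      rw [hD]; linarith
  rw [← ofReal_norm, Complex.norm_real, Real.norm_of_nonneg (h.spectrum_nonneg hθ), htr,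
    ← ENNReal.ofReal_pow (h.spectrum_nonneg hθ), ← ENNReal.ofReal_pow ht0,
    ← ENNReal.ofReal_mul (by positivity), ← ENNReal.ofReal_mul (by positivity)]
  refine ENNReal.ofReal_le_ofReal ((pow_le_pow_left₀ (h.spectrum_nonneg hθ) hup 2).trans
    (le_of_eq ?_))
  have : |θ| ^ (-2 * L) = (|θ| ^ (-L)) ^ 2 := by
    rw [← Real.rpow_natCast, ← Real.rpow_mul habs.le]; congr 1; push_cast; ring
  rw [this]; ring

theorem IsLRD.memLp_spectrum (h : IsLRD P X b A α 𝓜 m l L)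
    (hReg : ∫⁻ θ in Set.Icc (-Real.pi) Real.pi,
      traceNorm (𝓜 θ) ^ 2 * ENNReal.ofReal (|θ| ^ (-2 * L)) < ⊤) :
    IntegrableOn (fun θ => (spatialMeanSpectrum A 𝓜 θ : ℂ)) (Set.Icc (-Real.pi) Real.pi) ∧
    MemLp (fun θ => (spatialMeanSpectrum A 𝓜 θ : ℂ)) 2
      (volume.restrict (Set.Ioc (-Real.pi) Real.pi)) := by
  have hint : IntegrableOn (fun θ => (spatialMeanSpectrum A 𝓜 θ : ℂ))
      (Set.Icc (-Real.pi) Real.pi) :=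
    ((h.spectralDensity (oneL2 _) (oneL2 _)).1).congr_fun
      (fun θ hθ => h.ofReal_spectrum hθ) measurableSet_Icc
  refine ⟨hint, (hint.mono_set Set.Ioc_subset_Icc_self).aestronglyMeasurable, ?_⟩
  rw [eLpNorm_lt_top_iff_lintegral_rpow_enorm_lt_top two_ne_zero ENNReal.ofNat_ne_top]
  simp only [ENNReal.toReal_ofNat, ENNReal.rpow_ofNat]
  refine lt_of_le_of_lt (lintegral_mono_set Set.Ioc_subset_Icc_self) ?_
  refine lt_of_le_of_lt (lintegral_mono_ae ?_) ((lintegral_const_mul'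
    (ENNReal.ofReal ((Real.pi * (‖oneL2 (riemannianProb d M)‖ ^ 2 + 1)) ^ 2)) _
    ENNReal.ofReal_ne_top).trans_lt (ENNReal.mul_lt_top ENNReal.ofReal_lt_top hReg))
  filter_upwards [ae_restrict_mem measurableSet_Icc,
    ae_restrict_of_ae (Measure.ae_ne volume (0 : ℝ))] with θ hθ hθ0
  exact h.enorm_spectrum_sq_le hθ hθ0

end Spectral

/-- Square sums over a window of length `N` of a function of four times which only depends on the
differences. -/
theorem sum_shift_le_mul_tsum {g : ℤ × ℤ × ℤ → ℝ} (hg : Summable g) (hg0 : ∀ t, 0 ≤ g t) (N : ℕ) :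
    ∑ p ∈ Finset.range N ×ˢ Finset.range N, ∑ q ∈ Finset.range N ×ˢ Finset.range N,
      g ((p.1 : ℤ) - q.2, (p.2 : ℤ) - q.2, (q.1 : ℤ) - q.2) ≤ N * ∑' t, g t := by
  simp_rw [fun p : ℕ × ℕ => Finset.sum_product_right (Finset.range N) (Finset.range N)
    fun q : ℕ × ℕ => g ((p.1 : ℤ) - q.2, (p.2 : ℤ) - q.2, (q.1 : ℤ) - q.2)]
  rw [Finset.sum_comm]
  refine (Finset.sum_le_card_nsmul _ _ (∑' t, g t) fun e _ => ?_).trans (by simp)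
  rw [← Finset.sum_product']
  rw [← Finset.sum_image (s := (Finset.range N ×ˢ Finset.range N) ×ˢ Finset.range N)
    (g := fun x : (ℕ × ℕ) × ℕ => ((x.1.1 : ℤ) - e, (x.1.2 : ℤ) - e, (x.2 : ℤ) - e)) (f := g)]
  · exact hg.sum_le_tsum _ fun t _ => hg0 t
  · intro x _ y _ hxy
    simp only [Prod.mk.injEq, sub_left_inj, Nat.cast_inj] at hxy
    ext <;> simp [hxy]

theorem theorem4p3 {d : ℕ} (hd : 1 ≤ d)
    {M : Type*} [MetricSpace M] [CompactSpace M] [ConnectedSpace M]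
    [MeasurableSpace M] [BorelSpace M]
    [ChartedSpace (EuclideanSpace ℝ (Fin d)) M] [IsManifold (𝓡 d) ∞ M]
    [RiemannianBundle (fun x : M => TangentSpace (𝓡 d) x)]
    [IsContMDiffRiemannianBundle (𝓡 d) ∞ (EuclideanSpace ℝ (Fin d))
      (fun x : M => TangentSpace (𝓡 d) x)]
    [IsRiemannianManifold (𝓡 d) M] (hM : IsTwoPointHomogeneous M)
    (b : LaplaceBeltramiBasis d M)
    {Ω : Type*} [MeasurableSpace Ω] (P : Measure Ω) [IsProbabilityMeasure P]
    (X : ℤ → Ω → Lp ℝ 2 (riemannianProb d M)) (hX : IsStationarySeries P X)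
    (A : Lp ℂ 2 (riemannianProb d M) →L[ℂ] Lp ℂ 2 (riemannianProb d M)) (α : ℕ → ℝ)
    (𝓜 : ℝ → Lp ℂ 2 (riemannianProb d M) →L[ℂ] Lp ℂ 2 (riemannianProb d M)) (m : ℕ → ℝ → ℝ)
    (l L : ℝ) (hLRD : IsLRD P X b A α 𝓜 m l L) (hl : 1 / 4 < l)
    (hI : AssumptionI P X)
    (hReg : ∫⁻ θ in Set.Icc (-Real.pi) Real.pi,
      traceNorm (𝓜 θ) ^ 2 * ENNReal.ofReal (|θ| ^ (-2 * L)) < ⊤)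
    (W : ℝ → ℝ) (hW : IsWeightFunction W) (β : ℝ) (hβ : β ∈ Set.Ioo (0 : ℝ) 1) :
    ∀ᵐ w ∂P, Tendsto
      (fun T : ℕ => hilbertSchmidtNorm (riemannianProb d M)
        (testStatistic W ((T : ℝ) ^ (-β)) X T w))
      atTop atTop := by

  have hν := riemannianProb_univ_le_one (d := d) (M := M)
  have hmem := hX.memLp
  have hY := memLp_spatialMean hmem
  obtain ⟨γ, hγdef⟩ : ∃ γ : ℤ → ℝ, ∀ τ, γ τ = ∫ w, spatialMean X 0 w * spatialMean X τ w ∂P :=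
    ⟨_, fun _ => rfl⟩
  have h2 : ∀ s t : ℤ, ∫ w, spatialMean X s w * spatialMean X t w ∂P = γ (t - s) := by
    intro s t
    have h := inner_crossCov_oneL2 hmem s (s + (t - s))
    rw [hX.cov_shift, inner_crossCov_oneL2 hmem, Complex.ofReal_inj, ← hγdef] at h
    rw [h]; congr! 4; ring
  have hγ : ∀ τ : ℤ, (γ τ : ℂ) = ∫ θ in (-Real.pi)..Real.pi,
      Complex.exp (Complex.I * θ * τ) * (spatialMeanSpectrum A 𝓜 θ : ℂ) := by
    intro τ
    rw [hγdef, ← inner_crossCov_oneL2 hmem, (hLRD.spectralDensity _ _).2 τ]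
    refine intervalIntegral.integral_congr fun θ hθ => ?_
    rw [Set.uIcc_of_le (by linarith [Real.pi_pos])] at hθ
    simp only
    rw [hLRD.ofReal_spectrum hθ]
  obtain ⟨hint, hL2⟩ := hLRD.memLp_spectrum hReg
  have hφ : IntervalIntegrable (spatialMeanSpectrum A 𝓜) volume (-Real.pi) Real.pi := by
    rw [intervalIntegrable_iff_integrableOn_Icc_of_le (by linarith [Real.pi_pos])]
    exact hint.re
  obtain ⟨c, hc, hlow⟩ := hLRD.exists_le_spectrum
  have h4 : ∀ a b c e : ℤ, ∫ w, spatialMean X a w * spatialMean X b w *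
      (spatialMean X c w * spatialMean X e w) ∂P =
      γ (b - a) * γ (e - c) + γ (c - a) * γ (e - b) + γ (e - a) * γ (c - b) +
        integralL2 (Measure.pi fun _ => riemannianProb d M) (cum4 P X a b c e) := by
    intro a b c e
    rw [integral_spatialMean_four hmem]
    simp_rw [h2]
  set I := integralL2 (Measure.pi fun _ : Fin 4 => riemannianProb d M) with hIdef
  have hκ : ∀ N : ℕ, ∑ p ∈ Finset.range N ×ˢ Finset.range N,
      ∑ q ∈ Finset.range N ×ˢ Finset.range N,
        (I (cum4 P X p.1 p.2 q.1 q.2)) ^ 2 ≤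
      N * ∑' t : ℤ × ℤ × ℤ, ‖I‖ ^ 2 * ‖cum4 P X t.1 t.2.1 t.2.2 0‖ ^ 2 := by
    intro N
    refine le_trans (Finset.sum_le_sum fun p _ => Finset.sum_le_sum fun q _ => ?_)
      (sum_shift_le_mul_tsum (hI.summable_sq.mul_left _) (fun t => by positivity) N)
    have hshift := hX.cum_shift ((p.1 : ℤ) - q.2) ((p.2 : ℤ) - q.2) ((q.1 : ℤ) - q.2) 0 q.2
    simp only [sub_add_cancel, zero_add] at hshift
    rw [hshift, ← sq_abs, ← mul_pow]
    exact pow_le_pow_left₀ (abs_nonneg _) (I.le_opNorm _) 2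
  -- the bandwidth tends to zero
  have hB : ∀ᶠ T : ℕ in atTop, 0 < T ∧ 0 < (T : ℝ) ^ (-β) ∧ (T : ℝ) ^ (-β) ≤ 1 / 16 := by
    have h := (tendsto_rpow_neg_atTop hβ.1).comp tendsto_natCast_atTop_atTop
    filter_upwards [h.eventually_le_const (show (0 : ℝ) < 1 / 16 by norm_num),
      eventually_gt_atTop 0] with T hT hT0
    exact ⟨hT0, Real.rpow_pos_of_pos (by exact_mod_cast hT0) _, hT⟩
  have hmain := ae_tendsto_atTop_weighted_energy hY h2 h4 (summable_sq_of_spectral_memLp hL2 hγ)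
    hκ hφ hγ (fun θ hθ => hLRD.spectrum_nonneg hθ) hc hLRD.l_pos hlow hβ.2
    (a := fun T s => ∫ θ in (-√((T : ℝ) ^ (-β)) / 2)..(√((T : ℝ) ^ (-β)) / 2),
      periodizedWeight W ((T : ℝ) ^ (-β)) (θ - 2 * Real.pi * s / T))
    (hB.mono fun T hT s => hW.integral_periodizedWeight_nonneg hT.2.1)
    (hB.mono fun T hT s hs hnear => by
      have hTpos : (0 : ℝ) < T := by exact_mod_cast hT.1
      refine hW.one_le_integral_periodizedWeight hT.2.1 hT.2.2 (by positivity) ?_ hnear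
      rw [div_le_iff₀ hTpos]
      have : (s : ℝ) ≤ T := by exact_mod_cast hs.le
      have := Real.two_pi_pos
      gcongr)
  filter_upwards [hmain] with w hw
  refine tendsto_atTop_mono' _ ?_ hw
  filter_upwards [hB] with T hT
  exact le_hilbertSchmidtNorm_testStatistic hν hW hT.2.1 hT.2.2 hT.1
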